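/- Let $d\ge 0$ be an integer and let $G$ be a (finite or infinite) simple graph in which every vertex has degree at most $d$. Let $\mu$ be the law of a family $\omega=(\omega_v)_{v\in V(G)}$ of independent labels, each uniform on $[0,1]$. Then there is a map $F$ from $[0,1]^{V(G)}$ to $\{1,\dots,4^{d(d+1)/2}\}^{V(G)}$ with the following properties. (i) (Factor of iid.) $F$ is measurable and commutes with all automorphisms of $G$: $F(\omega\circ\varphi)=F(\omega)\circ\varphi$ for every automorphism $\varphi$ of $G$ and every $\omega$. (ii) (Finitary.) For every vertex $v$ and $\mu$-almost every $\omega$ there is a finite $r$ such that $F(\omega')_v=F(\omega)_v$ for every $\omega'$ that agrees with $\omega$ on the ball of radius $r$ around $v$ in $G$. (iii) (Proper coloring.) $\mu$-almost surely, any two adjacent vertices $u,v$ of $G$ satisfy $F(\omega)_u\ne F(\omega)_v$ (if $V(G)$ is uncountable, this holds almost surely on every given countable set of vertices). (iv) ($4$-dependent.) For all sets $A,B$ of vertices at graph distance greater than $4$ from each other (vertices in different components are at infinite distance), the restrictions of $F(\omega)$ to $A$ and to $B$ are independent under $\mu$. -/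

import Mathlib

open MeasureTheory ProbabilityTheory
open scoped unitInterval

/-- The law of a family of independent labels, uniform on `[0,1]`, one for each element of `V`. -/
noncomputable def iidUniform (V : Type*) : Measure (V → I) :=
  Measure.infinitePi (fun _ : V => (volume : Measure I))

/-- A random decoration `X` of the vertices of `G` (a process on the probability space `(Ω, μ)`)
is `k`-dependent if its restrictions to `A` and to `B` are independent whenever `A` and `B` are at
graph distance greater than `k`. The distance of vertices in different components is `⊤`. -/
def IsKDependent {V Ω C : Type*} [MeasurableSpace Ω] [MeasurableSpace C]
    (G : SimpleGraph V) (k : ℕ) (X : Ω → V → C) (μ : Measure Ω) : Prop :=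
  ∀ A B : Set V, (∀ a ∈ A, ∀ b ∈ B, (k : ℕ∞) < G.edist a b) →
    IndepFun (fun ω (a : A) => X ω a) (fun ω (b : B) => X ω b) μ

/-- A factor map from `[0,1]`-labellings of the vertices of `G` to `C`-decorations of the vertices
of `G`: a measurable map that commutes with all automorphisms of `G`. Its value at iid uniform
labels is a factor of iid. -/
def IsFactorMap {V C : Type*} [MeasurableSpace C]
    (G : SimpleGraph V) (F : (V → I) → V → C) : Prop :=
  Measurable F ∧ ∀ (φ : G ≃g G) (ω : V → I) (v : V), F (ω ∘ φ) v = F ω (φ v)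

/-- The map `F` is finitary at iid uniform labels: for every vertex `v`, almost surely, the value
at `v` is determined by the labels in some ball of finite (random) radius around `v`. -/
def IsFinitary {V C : Type*} (G : SimpleGraph V) (F : (V → I) → V → C) : Prop :=
  ∀ v : V, ∀ᵐ ω ∂(iidUniform V), ∃ r : ℕ, ∀ ω' : V → I,
    (∀ w : V, G.edist v w ≤ (r : ℕ∞) → ω' w = ω w) → F ω' v = F ω v

/-- A random decoration is almost surely a proper coloring. If `V` is countable, then `S` can be
all of `V`, and this says that almost surely any two adjacent vertices of `G` get different colors.
For uncountable `V`, where an uncountable union of null events cannot be controlled, this is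
required on every countable set of vertices. -/
def IsRandomProperColoring {V Ω C : Type*} [MeasurableSpace Ω]
    (G : SimpleGraph V) (X : Ω → V → C) (μ : Measure Ω) : Prop :=
  ∀ S : Set V, S.Countable → ∀ᵐ ω ∂μ, ∀ u ∈ S, ∀ v ∈ S, G.Adj u v → X ω u ≠ X ω v

/-! Split each label into an ordering label `U v` and independent sampling labels `W (v, c)`, one
for each pair `c` of distinct ranks. Every vertex ranks its neighbors by `U` and records one bit per
rank: whether the neighbor of that rank has a larger label. If `u`, `v` are adjacent with `U u < U
v` and equal bits, then the rank of `v` at `u` (bit true) differs from the rank of `u` at `v` (bit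
false), so the edge has a class, the unordered pair of these ranks. Equality of bits also forces the
edges of one class, directed towards the larger label, to form disjoint directed paths
(`IsStep.eq_left`, `IsStep.eq_right`). Almost surely each vertex has finitely many predecessors,
since `n` steps back need `n + 1` decreasing labels (`ae_exists_isPastList`).

Along each path, starting from its first vertex, the `W` labels sample the one-dependent 4-coloring
of Holroyd and Liggett. The bits together with one such color per class separate adjacent vertices,
and `2 ^ d * 4 ^ (d.choose 2)` colors are enough.

Dependence is controlled by one-dependence of the path coloring (`sum_buildings_insert`,
`sum_wordProb_insert`): forgetting the color of one vertex cuts its path into two independent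
pieces. So, given `U`, the law of the colors on a finite set `S` depends only on the bits in `S` and
on the steps with both ends in `S`, however long the paths are (`IsSampler.measure_pathColor`).
These are functions of `U` on the closed neighborhood of `S`, and the conditional law factorizes
over sets not joined by an edge. Integrating over `U` gives independence for sets with disjoint
closed neighborhoods (`measure_labelColor_union`). -/

open scoped ENNReal NNReal

/-! ### Proper buildings of words in four letters -/

/-- The number of proper buildings of a word of length `n`: orders in which its letters can be
inserted one at a time so that all intermediate words are proper. -/
def buildingsAux : ℕ → List (Fin 4) → ℕ
  | 0, _ => 1
  | n + 1, x => if x.IsChain (· ≠ ·) then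
      ∑ i ∈ Finset.range (n + 1), buildingsAux n (x.eraseIdx i) else 0

/-- The number of proper buildings of a word. -/
def buildings (x : List (Fin 4)) : ℕ := buildingsAux x.length x

/-- The total number of proper buildings of the words obtained by deleting one letter. -/
def deletionBuildings (x : List (Fin 4)) : ℕ :=
  ∑ i ∈ Finset.range x.length, buildings (x.eraseIdx i)

theorem buildings_nil : buildings [] = 1 := rfl

theorem buildings_of_isChain {x : List (Fin 4)} (h0 : x ≠ []) (hx : x.IsChain (· ≠ ·)) :
    buildings x = deletionBuildings x := by
  obtain ⟨n, hn⟩ : ∃ n, x.length = n + 1 :=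
    Nat.exists_eq_succ_of_ne_zero (by simpa using h0)
  unfold deletionBuildings buildings
  rw [hn, buildingsAux, if_pos hx]
  refine Finset.sum_congr rfl fun i hi => ?_
  rw [List.length_eraseIdx_of_lt (by rw [hn]; exact Finset.mem_range.1 hi), hn]
  rfl

theorem buildings_of_not_isChain {x : List (Fin 4)} (hx : ¬ x.IsChain (· ≠ ·)) :
    buildings x = 0 := by
  cases x with
  | nil => simp at hx
  | cons a l => rw [buildings, List.length_cons, buildingsAux, if_neg hx]

theorem deletionBuildings_insert (x y : List (Fin 4)) (a : Fin 4) :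
    deletionBuildings (x ++ a :: y) =
      ∑ i ∈ Finset.range x.length, buildings (x.eraseIdx i ++ a :: y) + buildings (x ++ y) +
        ∑ j ∈ Finset.range y.length, buildings (x ++ a :: y.eraseIdx j) := by
  unfold deletionBuildings
  rw [List.length_append, List.length_cons, ← add_assoc, add_right_comm, Finset.sum_range_add,
    Finset.sum_range_succ]
  congr 1
  · congr 1
    · refine Finset.sum_congr rfl fun i hi => ?_
      rw [List.eraseIdx_append_of_lt_length (Finset.mem_range.1 hi)]
    · rw [List.eraseIdx_append_of_length_le le_rfl]
      simp
  · refine Finset.sum_congr rfl fun j _ => ?_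
    rw [List.eraseIdx_append_of_length_le (by omega)]
    congr 2
    rw [show x.length + 1 + j - x.length = j + 1 by omega, List.eraseIdx_cons_succ]

theorem not_isChain_insert_head {x y : List (Fin 4)} {a : Fin 4} (h : a ∈ y.head?) :
    ¬ (x ++ a :: y).IsChain (· ≠ ·) := by
  intro hc
  cases y with
  | nil => simp at h
  | cons q y =>
    have := (List.isChain_append.1 hc).2.1
    simp at h
    simp [h] at this

theorem not_isChain_insert_getLast {x y : List (Fin 4)} {a : Fin 4} (h : a ∈ x.getLast?) :
    ¬ (x ++ a :: y).IsChain (· ≠ ·) := by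
  intro hc
  exact (List.isChain_append.1 hc).2.2 a h a (by simp) rfl

theorem isChain_insert_iff {x y : List (Fin 4)} (hx : x.IsChain (· ≠ ·)) (hy : y.IsChain (· ≠ ·))
    (a : Fin 4) :
    (x ++ a :: y).IsChain (· ≠ ·) ↔ a ∉ x.getLast? ∧ a ∉ y.head? := by
  refine ⟨fun h => ⟨fun h1 => not_isChain_insert_getLast h1 h,
    fun h1 => not_isChain_insert_head h1 h⟩, fun h => ?_⟩
  refine List.isChain_append.2 ⟨hx, List.isChain_cons.2 ⟨fun b hb e => h.2 (e ▸ hb), hy⟩, ?_⟩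
  intro b hb c hc e
  simp at hc
  exact h.1 (by rw [hc, ← e]; exact hb)

/-- A bad `a` repeats the last letter of `x` or the first letter of `y`. Deleting a letter of `x`
leaves the clash in place, except when the last letter of `x` is deleted and `a` equals it; the
result is then `x ++ y`. -/
theorem sum_not_proper_left {x y : List (Fin 4)} (hx : x.IsChain (· ≠ ·))
    (hy : y.IsChain (· ≠ ·)) (h0 : x ≠ []) :
    ∑ i ∈ Finset.range x.length, ∑ a with ¬ (x ++ a :: y).IsChain (· ≠ ·),
      buildings (x.eraseIdx i ++ a :: y) = buildings (x ++ y) := by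
  obtain ⟨x', p, rfl⟩ : ∃ x' p, x = x' ++ [p] := ⟨_, _, (List.dropLast_append_getLast h0).symm⟩
  rw [List.length_append, List.length_singleton, Finset.sum_range_succ, Finset.sum_eq_zero,
    zero_add, Finset.sum_eq_single p]
  · rw [List.eraseIdx_append_of_length_le le_rfl]
    simp
  · intro a ha hap
    rw [Finset.mem_filter, isChain_insert_iff hx hy] at ha
    have : a ∈ y.head? := by
      by_contra hc
      refine ha.2 ⟨?_, hc⟩
      simpa using hap.symm
    exact buildings_of_not_isChain (not_isChain_insert_head this)
  · intro hp
    exact absurd (by simp) hp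
  · intro i hi
    refine Finset.sum_eq_zero fun a ha => ?_
    rw [List.eraseIdx_append_of_lt_length (Finset.mem_range.1 hi)]
    rw [Finset.mem_filter, isChain_insert_iff hx hy] at ha
    apply buildings_of_not_isChain
    by_cases hc : a ∈ y.head?
    · exact not_isChain_insert_head hc
    · have : a ∈ (x' ++ [p]).getLast? := by
        by_contra h; exact ha.2 ⟨h, hc⟩
      exact not_isChain_insert_getLast (by simpa using this)

theorem sum_not_proper_right {x y : List (Fin 4)} (hx : x.IsChain (· ≠ ·))
    (hy : y.IsChain (· ≠ ·)) (h0 : y ≠ []) :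
    ∑ j ∈ Finset.range y.length, ∑ a with ¬ (x ++ a :: y).IsChain (· ≠ ·),
      buildings (x ++ a :: y.eraseIdx j) = buildings (x ++ y) := by
  obtain ⟨q, y', rfl⟩ := List.exists_cons_of_ne_nil h0
  rw [List.length_cons, Finset.sum_range_succ', Finset.sum_eq_zero,
    zero_add, Finset.sum_eq_single q]
  · simp
  · intro a ha haq
    rw [Finset.mem_filter, isChain_insert_iff hx hy] at ha
    have : a ∈ x.getLast? := by
      by_contra hc
      refine ha.2 ⟨hc, ?_⟩
      simpa using haq.symm
    exact buildings_of_not_isChain (not_isChain_insert_getLast this)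
  · intro hp
    exact absurd (by simp) hp
  · intro i hi
    refine Finset.sum_eq_zero fun a ha => ?_
    rw [List.eraseIdx_cons_succ]
    rw [Finset.mem_filter, isChain_insert_iff hx hy] at ha
    apply buildings_of_not_isChain
    by_cases hc : a ∈ x.getLast?
    · exact not_isChain_insert_getLast hc
    · have : a ∈ (q :: y').head? := by
        by_contra h; exact ha.2 ⟨hc, h⟩
      exact not_isChain_insert_head (by simpa using this)

/-- Each nonempty side forbids one letter, and the two forbidden letters differ when `x ++ y` is
proper; otherwise `buildings (x ++ y)` vanishes. This is where the number of colors, four, enters.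
-/
theorem card_proper_mul {x y : List (Fin 4)} (hx : x.IsChain (· ≠ ·)) (hy : y.IsChain (· ≠ ·)) :
    (Finset.univ.filter fun a => (x ++ a :: y).IsChain (· ≠ ·)).card * buildings (x ++ y) +
      (if x = [] then 0 else buildings (x ++ y)) + (if y = [] then 0 else buildings (x ++ y)) =
      4 * buildings (x ++ y) := by
  by_cases hxy : (x ++ y).IsChain (· ≠ ·)
  swap
  · simp [buildings_of_not_isChain hxy]
  simp only [isChain_insert_iff hx hy]
  rcases List.eq_nil_or_concat x with rfl | ⟨x', p, rfl⟩ <;> rcases y with _ | ⟨q, y⟩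
  · simp
  · have : ∀ q : Fin 4, (Finset.univ.filter fun a => q ≠ a).card = 3 := by decide
    simp [← ne_eq, this]
    ring
  · have : ∀ q : Fin 4, (Finset.univ.filter fun a => q ≠ a).card = 3 := by decide
    simp [← ne_eq, this]
    ring
  · have h := (List.isChain_append.1 hxy).2.2 p (by simp) q (by simp)
    have : ∀ p q : Fin 4, p ≠ q → (Finset.univ.filter fun a => p ≠ a ∧ q ≠ a).card = 2 := by
      decide
    simp [← ne_eq, this p q h]
    ring

/-- Condition on the letter inserted last. By induction, deletions in `x` and in `y` give the two
terms of Pascal's rule, once the improper choices of `a` are added; each nonempty side overcounts by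
`buildings (x ++ y)`. With both sides nonempty there are two proper choices of `a`, and deleting `a`
itself compensates the overcount exactly. -/
theorem sum_buildings_insert (x y : List (Fin 4)) :
    ∑ a, buildings (x ++ a :: y) =
      2 * (x.length + y.length + 2).choose (x.length + 1) * (buildings x * buildings y) := by
  induction hN : x.length + y.length using Nat.strong_induction_on generalizing x y with
  | _ N ih =>
  subst hN
  by_cases hx : x.IsChain (· ≠ ·)
  swap
  · rw [buildings_of_not_isChain hx, Finset.sum_eq_zero]
    · simp
    · exact fun a _ => buildings_of_not_isChain fun h => hx (List.isChain_append.1 h).1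
  by_cases hy : y.IsChain (· ≠ ·)
  swap
  · rw [buildings_of_not_isChain hy, Finset.sum_eq_zero]
    · simp
    · exact fun a _ => buildings_of_not_isChain fun h =>
        hy (List.isChain_cons.1 (List.isChain_append.1 h).2.1).2
  have hsum : ∑ a, buildings (x ++ a :: y) =
      ∑ i ∈ Finset.range x.length, ∑ a with (x ++ a :: y).IsChain (· ≠ ·),
        buildings (x.eraseIdx i ++ a :: y) +
      (Finset.univ.filter fun a => (x ++ a :: y).IsChain (· ≠ ·)).card * buildings (x ++ y) +
      ∑ j ∈ Finset.range y.length, ∑ a with (x ++ a :: y).IsChain (· ≠ ·),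
        buildings (x ++ a :: y.eraseIdx j) := by
    rw [← Finset.sum_filter_add_sum_filter_not _ (fun a => (x ++ a :: y).IsChain (· ≠ ·)),
      Finset.sum_congr rfl fun a ha =>
        (buildings_of_isChain (by simp) (Finset.mem_filter.1 ha).2).trans
          (deletionBuildings_insert x y a), Finset.sum_eq_zero (s := Finset.filter _ _)
        fun a ha => buildings_of_not_isChain (Finset.mem_filter.1 ha).2,
      Finset.sum_add_distrib, Finset.sum_add_distrib, Finset.sum_comm, add_zero,
      Finset.sum_comm (t := Finset.range y.length)]
    simp
  have hL : ∑ i ∈ Finset.range x.length, ∑ a, buildings (x.eraseIdx i ++ a :: y) =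
      2 * (x.length + y.length + 1).choose x.length * (deletionBuildings x * buildings y) := by
    rw [deletionBuildings, Finset.sum_mul, Finset.mul_sum]
    refine Finset.sum_congr rfl fun i hi => ?_
    have hi := Finset.mem_range.1 hi
    have hl := List.length_eraseIdx_of_lt hi
    rw [ih _ (by omega) _ _ rfl, hl]
    congr 3 <;> omega
  have hR : ∑ j ∈ Finset.range y.length, ∑ a, buildings (x ++ a :: y.eraseIdx j) =
      2 * (x.length + y.length + 1).choose (x.length + 1) *
        (buildings x * deletionBuildings y) := by
    rw [deletionBuildings, Finset.mul_sum, Finset.mul_sum]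
    refine Finset.sum_congr rfl fun i hi => ?_
    have hi := Finset.mem_range.1 hi
    have hl := List.length_eraseIdx_of_lt hi
    rw [ih _ (by omega) _ _ rfl, hl]
    congr 3; omega
  have hL' : ∑ i ∈ Finset.range x.length, ∑ a with (x ++ a :: y).IsChain (· ≠ ·),
        buildings (x.eraseIdx i ++ a :: y) + (if x = [] then 0 else buildings (x ++ y)) =
      2 * (x.length + y.length + 1).choose x.length * (deletionBuildings x * buildings y) := by
    rw [← hL]
    split_ifs with h
    · simp [h]
    · rw [← sum_not_proper_left hx hy h, ← Finset.sum_add_distrib]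
      exact Finset.sum_congr rfl fun i _ => Finset.sum_filter_add_sum_filter_not _ _ _
  have hR' : ∑ j ∈ Finset.range y.length, ∑ a with (x ++ a :: y).IsChain (· ≠ ·),
        buildings (x ++ a :: y.eraseIdx j) + (if y = [] then 0 else buildings (x ++ y)) =
      2 * (x.length + y.length + 1).choose (x.length + 1) *
        (buildings x * deletionBuildings y) := by
    rw [← hR]
    split_ifs with h
    · simp [h]
    · rw [← sum_not_proper_right hx hy h, ← Finset.sum_add_distrib]
      exact Finset.sum_congr rfl fun i _ => Finset.sum_filter_add_sum_filter_not _ _ _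
  have hC := card_proper_mul hx hy
  rw [Nat.choose_succ_succ (x.length + y.length + 1) x.length]
  by_cases h0 : x = [] <;> by_cases h1 : y = []
  · subst h0 h1
    simp [buildings, buildingsAux]
  -- The empty side has no deletions. Its term in Pascal's rule is replaced by the surplus: three
  -- proper letters minus one overcount leave `2 * buildings y`.
  · have e := buildings_of_isChain h1 hy
    subst h0
    simp [h1, deletionBuildings, buildings_nil] at hC hL' hR' e hsum ⊢
    rw [← e] at hR'
    rw [hsum]
    linarith
  · have e := buildings_of_isChain h0 hx
    subst h1
    simp [h0, deletionBuildings, buildings_nil, Nat.choose_succ_self_right] at hC hL' hR' e hsum ⊢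
    rw [← e] at hL'
    rw [hsum]
    linarith
  · rw [if_neg h0] at hL' hC
    rw [if_neg h1] at hR' hC
    rw [← buildings_of_isChain h0 hx] at hL'
    rw [← buildings_of_isChain h1 hy] at hR'
    rw [hsum]
    linarith

/-! ### The Holroyd–Liggett law and its sequential sampler -/

/-- The probability of a word under the one-dependent `4`-coloring of Holroyd and Liggett. -/
noncomputable def wordProb (x : List (Fin 4)) : ℝ≥0∞ :=
  ((buildings x / (2 ^ x.length * (x.length + 1).factorial) : ℝ≥0) : ℝ≥0∞)

theorem wordProb_nil : wordProb [] = 1 := by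
  simp [wordProb, buildings_nil]

theorem wordProb_ne_top (x : List (Fin 4)) : wordProb x ≠ ∞ := ENNReal.coe_ne_top

theorem wordProb_of_not_isChain {x : List (Fin 4)} (hx : ¬ x.IsChain (· ≠ ·)) :
    wordProb x = 0 := by
  simp [wordProb, buildings_of_not_isChain hx]

/-- The Holroyd-Liggett coloring is one-dependent. -/
theorem sum_wordProb_insert (x y : List (Fin 4)) :
    ∑ a, wordProb (x ++ a :: y) = wordProb x * wordProb y := by
  unfold wordProb
  rw [← ENNReal.coe_mul, ← ENNReal.ofNNReal_finsetSum, ENNReal.coe_inj]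
  have hl : ∀ a, (x ++ a :: y).length = x.length + y.length + 1 := fun a => by
    simp; omega
  simp_rw [hl]
  rw [← Finset.sum_div, ← Nat.cast_sum, sum_buildings_insert]
  -- The binomial coefficient turns the factorial for the long word into the product of the two
  -- shorter ones, and the factor `2` accounts for the additional letter in the power of two.
  have hf := Nat.add_choose_mul_factorial_mul_factorial (x.length + 1) (y.length + 1)
  rw [show x.length + 1 + (y.length + 1) = x.length + y.length + 2 by ring] at hf
  rw [show x.length + y.length + 1 + 1 = x.length + y.length + 2 by ring, ← hf]
  rw [Nat.choose_symm_of_eq_add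
    (show x.length + y.length + 2 = y.length + 1 + (x.length + 1) by ring)]
  have h1 : (((x.length + y.length + 2).choose (x.length + 1) : ℕ) : ℝ≥0) ≠ 0 := by
    exact_mod_cast (Nat.choose_pos (by omega)).ne'
  have h2 : ((x.length + 1).factorial : ℝ≥0) ≠ 0 := by exact_mod_cast Nat.factorial_ne_zero _
  have h3 : ((y.length + 1).factorial : ℝ≥0) ≠ 0 := by exact_mod_cast Nat.factorial_ne_zero _
  push_cast
  field_simp
  ring

theorem sum_wordProb_cons (x : List (Fin 4)) : ∑ a, wordProb (a :: x) = wordProb x := by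
  simpa [wordProb_nil] using sum_wordProb_insert [] x

/-- The conditional law of the next letter, `wordProb (a :: x) / wordProb x`, is realized as a
function of one uniform label. The multiplied form of the identity also covers words of probability
zero. -/
theorem exists_sampler_word (x : List (Fin 4)) :
    ∃ h : I → Fin 4, Measurable h ∧ (∀ a, volume {w | h w = a} * wordProb x = wordProb (a :: x)) ∧
      ∀ w, h w ∉ x.head? := by
  obtain ⟨h, hm, hl⟩ : ∃ h : I → Fin 4, Measurable h ∧
      ∀ a, volume {w | h w = a} * wordProb x = wordProb (a :: x) := by
    by_cases h0 : wordProb x = 0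
    · refine ⟨fun _ => 0, measurable_const, fun a => ?_⟩
      rw [h0, mul_zero]
      have := sum_wordProb_cons x
      rw [h0] at this
      exact ((Finset.sum_eq_zero_iff.1 this) a (Finset.mem_univ a)).symm
    · let p : PMF (Fin 4) := PMF.ofFintype (fun a => wordProb (a :: x) / wordProb x) (by
        simp_rw [div_eq_mul_inv]
        rw [← Finset.sum_mul, sum_wordProb_cons, ENNReal.mul_inv_cancel h0 (wordProb_ne_top x)])
      obtain ⟨h, hm, hh⟩ := Measure.exists_measurable_map_eq p.toMeasure
      refine ⟨h, hm, fun a => ?_⟩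
      have e : {w | h w = a} = h ⁻¹' {a} := rfl
      rw [e, ← Measure.map_apply hm (measurableSet_singleton a), hh,
        PMF.toMeasure_apply_singleton _ _ (measurableSet_singleton a)]
      exact ENNReal.div_mul_cancel h0 (wordProb_ne_top x)
  cases x with
  | nil => exact ⟨h, hm, hl, by simp⟩
  | cons b x =>
    have hb : volume {w | h w = b} * wordProb (b :: x) = 0 := by
      rw [hl, wordProb_of_not_isChain (by simp)]
    -- Unless the word itself is null, the letter `b` has probability zero, so redirecting it to any
    -- other letter keeps the law and makes properness hold for every label.
    refine ⟨fun w => if h w = b then b + 1 else h w,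
      Measurable.ite (hm (measurableSet_singleton b)) measurable_const hm, fun a => ?_, fun w => ?_⟩
    · rcases mul_eq_zero.1 hb with h0 | h0
      · rw [← hl a]
        congr 1
        refine measure_congr (Filter.eventuallyEq_set.2 ?_)
        have : ∀ᵐ w, h w ≠ b := by simpa [ae_iff] using h0
        filter_upwards [this] with w hw
        simp [hw]
      · rw [← hl, h0, mul_zero, mul_zero]
    · have : ∀ b : Fin 4, b ≠ b + 1 := by decide
      simp only [List.head?_cons, Option.mem_def, Option.some.injEq]
      split_ifs with h1
      · exact this b
      · exact fun h2 => h1 h2.symm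

/-- A sampler extends each word by a letter, using one uniform label, so that successive extensions
of the empty word follow the Holroyd-Liggett law and are always proper. -/
structure IsSampler (h : List (Fin 4) → I → Fin 4) : Prop where
  measurable : ∀ x, Measurable (h x)
  volume_mul : ∀ x a, volume {w | h x w = a} * wordProb x = wordProb (a :: x)
  notMem_head : ∀ x w, h x w ∉ x.head?

theorem exists_isSampler : ∃ h, IsSampler h := by
  choose h h1 h2 h3 using exists_sampler_word
  exact ⟨h, h1, h2, h3⟩

/-! ### Disjoint directed paths and weights of their colorings -/

/-- `bk k` lists the predecessors of `k`, from the closest one on, in a union of disjoint directed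
paths, each of which has a first vertex. -/
structure IsPast {K : Type*} (bk : K → List K) : Prop where
  eq_past : ∀ k u l, bk k = u :: l → l = bk u
  head_injective : ∀ k k' u, u ∈ (bk k).head? → u ∈ (bk k').head? → k = k'

section PathWeights

variable {K : Type*}

theorem IsPast.length_lt {bk : K → List K} (hb : IsPast bk) {k i : K} (hi : i ∈ bk k) :
    (bk i).length < (bk k).length := by
  induction hn : (bk k).length generalizing k with
  | zero => simp [List.length_eq_zero_iff.1 hn] at hi
  | succ n ih =>
    obtain ⟨u, l, hl⟩ := List.exists_cons_of_length_eq_add_one hn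
    have h1 := hb.eq_past k u l hl
    have h2 : (bk u).length = n := by rw [← h1]; simpa [hl] using hn
    rw [hl, List.mem_cons] at hi
    rcases hi with rfl | hi
    · omega
    · exact (ih (h1 ▸ hi) h2).trans (by omega)

open Classical in
/-- The predecessors of `k` that are reached without leaving `D`. -/
noncomputable def pastWithin (bk : K → List K) (D : Finset K) (k : K) : List K :=
  (bk k).takeWhile (· ∈ D)

theorem pastWithin_eq_cons {bk : K → List K} (hb : IsPast bk) {D : Finset K} {k u : K}
    (hu : u ∈ (bk k).head?) (hD : u ∈ D) : pastWithin bk D k = u :: pastWithin bk D u := by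
  cases h : bk k with
  | nil => simp [h] at hu
  | cons v l =>
    obtain rfl : v = u := by simpa [h] using hu
    rw [pastWithin, h, List.takeWhile_cons, if_pos (by simpa using hD), hb.eq_past k v l h]
    rfl

theorem pastWithin_eq_nil {bk : K → List K} {D : Finset K} {k : K}
    (h : ∀ u ∈ (bk k).head?, u ∉ D) : pastWithin bk D k = [] := by
  cases hk : bk k with
  | nil => simp [pastWithin, hk]
  | cons v l =>
    rw [pastWithin, hk, List.takeWhile_cons, if_neg]
    simpa [hk] using h

theorem pastWithin_cases {bk : K → List K} (hb : IsPast bk) (D : Finset K) (k : K) :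
    (pastWithin bk D k = [] ∧ ∀ u ∈ (bk k).head?, u ∉ D) ∨
      ∃ u, u ∈ (bk k).head? ∧ u ∈ D ∧ pastWithin bk D k = u :: pastWithin bk D u := by
  by_cases h : ∃ u ∈ (bk k).head?, u ∈ D
  · obtain ⟨u, hu, hD⟩ := h
    exact Or.inr ⟨u, hu, hD, pastWithin_eq_cons hb hu hD⟩
  · push Not at h
    exact Or.inl ⟨pastWithin_eq_nil h, h⟩

theorem mem_of_mem_pastWithin {bk : K → List K} {D : Finset K} {k i : K}
    (h : i ∈ pastWithin bk D k) : i ∈ D := by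
  simpa using List.mem_takeWhile_imp h

theorem mem_past_of_mem_pastWithin {bk : K → List K} {D : Finset K} {k i : K}
    (h : i ∈ pastWithin bk D k) : i ∈ bk k :=
  (List.takeWhile_sublist _).subset h

theorem nodup_cons_pastWithin {bk : K → List K} (hb : IsPast bk) (D : Finset K) (k : K) :
    (k :: pastWithin bk D k).Nodup := by
  induction hn : pastWithin bk D k generalizing k with
  | nil => simp
  | cons u l ih =>
    rcases pastWithin_cases hb D k with ⟨h, -⟩ | ⟨v, -, -, h⟩
    · simp [h] at hn
    · rw [hn, List.cons.injEq] at h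
      obtain ⟨rfl, rfl⟩ := h
      refine List.nodup_cons.2 ⟨fun hk => ?_, ih u rfl⟩
      rw [← hn] at hk
      exact lt_irrefl _ (hb.length_lt (mem_past_of_mem_pastWithin hk))

/-- The walk backwards from `k` never leaves `D`, and at each vertex of `D` both systems offer the
same admissible predecessor. -/
theorem pastWithin_congr {bk bk' : K → List K} (hb : IsPast bk) (hb' : IsPast bk')
    {D D₁ D₂ : Finset K}
    (h : ∀ k ∈ D, ∀ u, (u ∈ (bk k).head? ∧ u ∈ D₁) ↔ (u ∈ (bk' k).head? ∧ u ∈ D₂))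
    (hD : ∀ k ∈ D, ∀ u, u ∈ (bk k).head? → u ∈ D₁ → u ∈ D) {k : K} (hk : k ∈ D) :
    pastWithin bk D₁ k = pastWithin bk' D₂ k := by
  induction hn : pastWithin bk D₁ k generalizing k with
  | nil =>
    rcases pastWithin_cases hb D₁ k with ⟨-, h1⟩ | ⟨v, -, -, h1⟩
    · exact (pastWithin_eq_nil fun u hu hu' =>
        h1 u ((h k hk u).2 ⟨hu, hu'⟩).1 ((h k hk u).2 ⟨hu, hu'⟩).2).symm
    · simp [h1] at hn
  | cons u l ih =>
    rcases pastWithin_cases hb D₁ k with ⟨h1, -⟩ | ⟨v, h2, h3, h1⟩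
    · simp [h1] at hn
    · rw [hn, List.cons.injEq] at h1
      obtain ⟨rfl, rfl⟩ := h1
      have h4 := (h k hk u).1 ⟨h2, h3⟩
      rw [pastWithin_eq_cons hb' h4.1 h4.2, ih (hD k hk u h2 h3) rfl]

theorem exists_append_pastWithin {bk : K → List K} (hb : IsPast bk) {D : Finset K} {f k : K}
    (hk : k ∈ f :: pastWithin bk D f) :
    ∃ s, f :: pastWithin bk D f = s ++ k :: pastWithin bk D k := by
  induction hn : pastWithin bk D f generalizing f with
  | nil =>
    rw [hn, List.mem_singleton] at hk
    subst hk
    exact ⟨[], by simp [hn]⟩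
  | cons u l ih =>
    rcases pastWithin_cases hb D f with ⟨h1, -⟩ | ⟨v, -, -, h1⟩
    · simp [h1] at hn
    · rw [hn, List.cons.injEq] at h1
      obtain ⟨rfl, rfl⟩ := h1
      rw [hn, List.mem_cons] at hk
      rcases hk with rfl | hk
      · exact ⟨[], by simp [hn]⟩
      · obtain ⟨s, hs⟩ := ih hk rfl
        exact ⟨f :: s, by rw [hs]; rfl⟩

theorem isChain_pastWithin {bk : K → List K} (hb : IsPast bk) (D : Finset K) (k : K) :
    (k :: pastWithin bk D k).IsChain (fun y x => x ∈ (bk y).head?) := by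
  induction hn : pastWithin bk D k generalizing k with
  | nil => simp
  | cons u l ih =>
    rcases pastWithin_cases hb D k with ⟨h, -⟩ | ⟨v, hv, -, h⟩
    · simp [h] at hn
    · rw [hn, List.cons.injEq] at h
      obtain ⟨rfl, rfl⟩ := h
      exact List.isChain_cons_cons.2 ⟨hv, ih u rfl⟩

/-- Successors are unique, so two chains that end in `k` agree above `k` as far as the shorter one
reaches. -/
theorem isSuffix_of_isChain {R : K → K → Prop} (hR : ∀ y y' x, R y x → R y' x → y = y')
    {s s' : List K} {k : K} {l l' : List K} (h : (s ++ k :: l).IsChain R)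
    (h' : (s' ++ k :: l').IsChain R) (hs : s'.length ≤ s.length) : s' <:+ s := by
  induction s' using List.reverseRecOn generalizing s k l l' with
  | nil => exact List.nil_suffix
  | append_singleton s' p' ih =>
    rcases List.eq_nil_or_concat s with rfl | ⟨s, p, rfl⟩
    · simp at hs
    · rw [List.concat_eq_append] at *
      simp only [List.append_assoc, List.singleton_append] at h h'
      have h1 := (List.isChain_cons_cons.1 (List.isChain_append.1 h).2.1).1
      have h2 := (List.isChain_cons_cons.1 (List.isChain_append.1 h').2.1).1
      obtain rfl := hR _ _ _ h1 h2
      obtain ⟨t, rfl⟩ := ih h h' (by simpa using hs)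
      exact ⟨t, by simp⟩

/-- The density of the random coloring along the paths, observed on the finite set `D`. -/
noncomputable def pathWeight (r : Fin 4 → List (Fin 4) → ℝ≥0∞) (bk : K → List K) (D : Finset K)
    (a : K → Fin 4) : ℝ≥0∞ :=
  ∏ k ∈ D, r (a k) ((pastWithin bk D k).map a)

variable {r : Fin 4 → List (Fin 4) → ℝ≥0∞}

/-- The source of locality: the weight sees only those links whose two ends both lie in `D`. -/
theorem pathWeight_congr_past {bk bk' : K → List K} (hb : IsPast bk) (hb' : IsPast bk')
    {D : Finset K} (h : ∀ k ∈ D, ∀ u ∈ D, u ∈ (bk k).head? ↔ u ∈ (bk' k).head?)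
    (a : K → Fin 4) : pathWeight r bk D a = pathWeight r bk' D a := by
  refine Finset.prod_congr rfl fun k hk => ?_
  rw [pastWithin_congr hb hb' (D := D) (D₂ := D) (fun k hk u => ?_) (fun _ _ _ _ h => h) hk]
  exact ⟨fun hu => ⟨(h k hk u hu.2).1 hu.1, hu.2⟩, fun hu => ⟨(h k hk u hu.2).2 hu.1, hu.2⟩⟩

open Classical in
theorem pathWeight_union {bk : K → List K} (hb : IsPast bk) {D D' : Finset K}
    (hd : Disjoint D D') (h : ∀ k ∈ D, ∀ u ∈ D', u ∉ (bk k).head?)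
    (h' : ∀ k ∈ D', ∀ u ∈ D, u ∉ (bk k).head?) (a : K → Fin 4) :
    pathWeight r bk (D ∪ D') a = pathWeight r bk D a * pathWeight r bk D' a := by
  rw [pathWeight, Finset.prod_union hd]
  congr 1
  · refine Finset.prod_congr rfl fun k hk => ?_
    rw [pastWithin_congr hb hb (D := D) (D₁ := D ∪ D') (D₂ := D) _ _ hk]
    · intro k hk u
      have := h k hk u
      grind
    · intro k hk u
      have := h k hk u
      grind
  · refine Finset.prod_congr rfl fun k hk => ?_
    rw [pastWithin_congr hb hb (D := D') (D₁ := D ∪ D') (D₂ := D') _ _ hk]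
    · intro k hk u
      have := h' k hk u
      grind
    · intro k hk u
      have := h' k hk u
      grind

/-- Chain rule: the conditional probabilities along a segment telescope to the probability of its
word. -/
theorem prod_cons_pastWithin (hr : ∀ a x, r a x * wordProb x = wordProb (a :: x))
    {bk : K → List K} (hb : IsPast bk) (D : Finset K) (a : K → Fin 4) (k : K) :
    ((k :: pastWithin bk D k).map fun i => r (a i) ((pastWithin bk D i).map a)).prod =
      wordProb ((k :: pastWithin bk D k).map a) := by
  induction hn : pastWithin bk D k generalizing k with
  | nil =>
    have := hr (a k) []
    rw [wordProb_nil, mul_one] at this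
    simp [hn, this]
  | cons u l ih =>
    rcases pastWithin_cases hb D k with ⟨h, -⟩ | ⟨v, hv, -, h⟩
    · simp [h] at hn
    · rw [hn, List.cons.injEq] at h
      obtain ⟨rfl, rfl⟩ := h
      rw [List.map_cons, List.prod_cons, ih u rfl, hn, hr]
      rfl

theorem prod_pastWithin (hr : ∀ a x, r a x * wordProb x = wordProb (a :: x))
    {bk : K → List K} (hb : IsPast bk) (D : Finset K) (a : K → Fin 4) (k : K) :
    ((pastWithin bk D k).map fun i => r (a i) ((pastWithin bk D i).map a)).prod =
      wordProb ((pastWithin bk D k).map a) := by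
  rcases pastWithin_cases hb D k with ⟨h, -⟩ | ⟨v, hv, -, h⟩
  · simp [h, wordProb_nil]
  · rw [h, prod_cons_pastWithin hr hb]

open Classical in
theorem pastWithin_erase_of_notMem {bk : K → List K} {D : Finset K} {j k : K}
    (h : k ∉ pastWithin bk D j) : pastWithin bk (D.erase k) j = pastWithin bk D j := by
  unfold pastWithin at *
  generalize bk j = l at *
  induction l with
  | nil => simp
  | cons u l ih =>
    by_cases hu : u ∈ D
    · rw [List.takeWhile_cons_of_pos (by simpa using hu)] at h
      simp only [List.mem_cons, not_or] at h
      have hne : u ≠ k := Ne.symm h.1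
      rw [List.takeWhile_cons_of_pos (by simp [hu, hne]), ih h.2,
        List.takeWhile_cons_of_pos (by simpa using hu)]
    · rw [List.takeWhile_cons_of_neg (by simp [hu]), List.takeWhile_cons_of_neg (by simp [hu])]

open Classical in
theorem pastWithin_erase_of_append {bk : K → List K} {D : Finset K} {j k : K} {s l : List K}
    (h : pastWithin bk D j = s ++ k :: l) (hk : k ∉ s) :
    pastWithin bk (D.erase k) j = s := by
  unfold pastWithin at *
  generalize bk j = m at *
  induction m generalizing s with
  | nil => simp at h
  | cons u m ih =>
    by_cases hu : u ∈ D
    · rw [List.takeWhile_cons_of_pos (by simpa using hu)] at h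
      cases s with
      | nil =>
        simp only [List.nil_append, List.cons.injEq] at h
        rw [List.takeWhile_cons_of_neg (by simp [h.1])]
      | cons v s =>
        simp only [List.cons_append, List.cons.injEq] at h
        obtain ⟨rfl, h⟩ := h
        simp only [List.mem_cons, not_or] at hk
        have hne : u ≠ k := Ne.symm hk.1
        rw [List.takeWhile_cons_of_pos (by simp [hu, hne]), ih hk.2 h]
    · rw [List.takeWhile_cons_of_neg (by simp [hu])] at h
      simp at h

open Classical in
/-- Summing over the color of one vertex amounts to ignoring that vertex. -/
theorem sum_pathWeight_update (hr : ∀ a x, r a x * wordProb x = wordProb (a :: x))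
    {bk : K → List K} (hb : IsPast bk) {D : Finset K} {k : K} (hk : k ∈ D) (a : K → Fin 4) :
    ∑ c, pathWeight r bk D (Function.update a k c) = pathWeight r bk (D.erase k) a := by
  -- `f` is the last vertex of `D` on the path of `k` from which `k` is reached inside `D`. The
  -- segment from `f` back is `s ++ k :: l`, with `s` after and `l` before `k` on the path.
  obtain ⟨f, hf, hmax⟩ := Finset.exists_max_image
    (D.filter fun f => k ∈ f :: pastWithin bk D f) (fun f => (pastWithin bk D f).length)
    ⟨k, by simp [hk]⟩
  rw [Finset.mem_filter] at hf
  obtain ⟨s, hs⟩ := exists_append_pastWithin hb hf.2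
  set l := pastWithin bk D k with hl
  have hnd : (s ++ k :: l).Nodup := hs ▸ nodup_cons_pastWithin hb D f
  have hks : k ∉ s := fun h => (List.nodup_append.1 hnd).2.2 k h k (by simp) rfl
  have hkl : k ∉ l := (List.nodup_cons.1 (List.nodup_append.1 hnd).2.1).1
  have hLD : (s ++ k :: l).toFinset ⊆ D := by
    intro i hi
    rw [List.mem_toFinset, ← hs, List.mem_cons] at hi
    rcases hi with rfl | hi
    · exact hf.1
    · exact mem_of_mem_pastWithin hi
  -- By uniqueness of successors and maximality of `f`, every vertex of `D` whose weight involves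
  -- the color of `k` lies on this segment.
  have hrest : ∀ j ∈ D \ (s ++ k :: l).toFinset, k ∉ j :: pastWithin bk D j := by
    intro j hj hkj
    rw [Finset.mem_sdiff, List.mem_toFinset] at hj
    obtain ⟨s', hs'⟩ := exists_append_pastWithin hb hkj
    have hle := hmax j (Finset.mem_filter.2 ⟨hj.1, hkj⟩)
    have e1 := congrArg List.length hs
    have e2 := congrArg List.length hs'
    simp only [List.length_cons, List.length_append, ← hl] at e1 e2
    have hsuf := isSuffix_of_isChain (fun y y' x => hb.head_injective y y' x)
      (hs ▸ isChain_pastWithin hb D f) (hs' ▸ isChain_pastWithin hb D j)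
      (show s'.length ≤ s.length by omega)
    cases s' with
    | nil =>
      simp only [List.nil_append, List.cons.injEq] at hs'
      exact hj.2 (by simp [hs'.1])
    | cons i s' =>
      simp only [List.cons_append, List.cons.injEq] at hs'
      exact hj.2 (by simp [hsuf.subset (show j ∈ i :: s' by simp [hs'.1])])
  have h1 : ∀ c, pathWeight r bk D (Function.update a k c) =
      (∏ j ∈ D \ (s ++ k :: l).toFinset, r (a j) ((pastWithin bk (D.erase k) j).map a)) *
        wordProb (s.map a ++ c :: l.map a) := by
    intro c
    rw [pathWeight, ← Finset.prod_sdiff hLD]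
    congr 1
    · refine Finset.prod_congr rfl fun j hj => ?_
      have h2 := hrest j hj
      simp only [List.mem_cons, not_or] at h2
      rw [Function.update_of_ne (Ne.symm h2.1), pastWithin_erase_of_notMem h2.2]
      congr 1
      refine List.map_congr_left fun i hi => Function.update_of_ne ?_ _ _
      rintro rfl
      exact h2.2 hi
    · rw [List.prod_toFinset _ hnd, ← hs, prod_cons_pastWithin hr hb, hs, List.map_append,
        List.map_cons, Function.update_self]
      congr 2
      · exact List.map_congr_left fun i hi => Function.update_of_ne
          (by rintro rfl; exact hks hi) _ _
      · congr 1
        exact List.map_congr_left fun i hi => Function.update_of_ne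
          (by rintro rfl; exact hkl hi) _ _
  -- Removing `k` breaks the segment into `s` and `l`, each of which telescopes by itself;
  -- one-dependence of `wordProb` then matches the two sides.
  have h2 : pathWeight r bk (D.erase k) a =
      (∏ j ∈ D \ (s ++ k :: l).toFinset, r (a j) ((pastWithin bk (D.erase k) j).map a)) *
        (wordProb (s.map a) * wordProb (l.map a)) := by
    have hLe : (s ++ l).toFinset ⊆ D.erase k := by
      intro i hi
      have hi' : i ∈ s ∨ i ∈ l := by simpa using hi
      refine Finset.mem_erase.2 ⟨?_, hLD (by simp; tauto)⟩
      rintro rfl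
      tauto
    have he : D.erase k \ (s ++ l).toFinset = D \ (s ++ k :: l).toFinset := by
      ext i
      simp
      tauto
    have hnd' : (s ++ l).Nodup := hnd.sublist (by simp)
    rw [pathWeight, ← Finset.prod_sdiff hLe, he, List.prod_toFinset _ hnd', List.map_append,
      List.prod_append]
    congr 2
    · cases s with
      | nil => simp [wordProb_nil]
      | cons i s =>
        simp only [List.cons_append, List.cons.injEq] at hs
        obtain ⟨rfl, hs⟩ := hs
        simp only [List.mem_cons, not_or] at hks
        rw [← pastWithin_erase_of_append hs hks.2, prod_cons_pastWithin hr hb]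
    · have : pastWithin bk (D.erase k) k = l := pastWithin_erase_of_notMem hkl
      rw [← this, prod_pastWithin hr hb]
  simp_rw [h1]
  rw [← Finset.mul_sum, sum_wordProb_insert, h2]

end PathWeights

/-! ### Coloring the paths with iid labels -/

section PathColoring

variable {K : Type*}

/-- The word sampled along a path, whose first vertex is the last entry of the list. -/
def pathWord (h : List (Fin 4) → I → Fin 4) (W : K → I) : List K → List (Fin 4)
  | [] => []
  | k :: l => h (pathWord h W l) (W k) :: pathWord h W l

/-- The random coloring along the paths. -/
def pathColor (h : List (Fin 4) → I → Fin 4) (bk : K → List K) (W : K → I) (k : K) : Fin 4 :=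
  h (pathWord h W (bk k)) (W k)

theorem pathWord_past {h : List (Fin 4) → I → Fin 4} {bk : K → List K} (hb : IsPast bk)
    (W : K → I) (k : K) : pathWord h W (bk k) = (bk k).map (pathColor h bk W) := by
  induction hn : bk k generalizing k with
  | nil => rfl
  | cons u l ih =>
    obtain rfl := hb.eq_past k u l hn
    rw [pathWord, ih u rfl, List.map_cons, pathColor, ih u rfl]

theorem IsSampler.measurableSet_pathWord {h : List (Fin 4) → I → Fin 4} (hh : IsSampler h)
    (l : List K) (x : List (Fin 4)) : MeasurableSet {W : K → I | pathWord h W l = x} := by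
  induction l generalizing x with
  | nil => exact MeasurableSet.const ([] = x)
  | cons k l ih =>
    cases x with
    | nil => simp [pathWord]
    | cons a x =>
      have : {W : K → I | pathWord h W (k :: l) = a :: x} =
          {W : K → I | h x (W k) = a} ∩ {W : K → I | pathWord h W l = x} := by
        ext W
        simp only [pathWord, List.cons.injEq, Set.mem_inter_iff, Set.mem_ofPred_eq]
        constructor
        · rintro ⟨h1, h2⟩
          exact ⟨h2 ▸ h1, h2⟩
        · rintro ⟨h1, h2⟩
          exact ⟨h2.symm ▸ h1, h2⟩
      rw [this]
      exact (((hh.measurable x).comp (measurable_pi_apply k))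
        (measurableSet_singleton a)).inter (ih x)

theorem IsSampler.measurable_sample {h : List (Fin 4) → I → Fin 4} (hh : IsSampler h)
    (l : List K) (k : K) : Measurable fun W : K → I => h (pathWord h W l) (W k) := by
  refine measurable_to_countable' fun a => ?_
  have : (fun W : K → I => h (pathWord h W l) (W k)) ⁻¹' {a} =
      ⋃ x, {W : K → I | h x (W k) = a} ∩ {W : K → I | pathWord h W l = x} := by
    ext W
    simp
  rw [this]
  exact MeasurableSet.iUnion fun x => (((hh.measurable x).comp (measurable_pi_apply k))
    (measurableSet_singleton a)).inter (hh.measurableSet_pathWord l x)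

theorem IsSampler.pathColor_ne {h : List (Fin 4) → I → Fin 4} (hh : IsSampler h)
    {bk : K → List K} (hb : IsPast bk) {k u : K} (hu : u ∈ (bk k).head?) (W : K → I) :
    pathColor h bk W k ≠ pathColor h bk W u := by
  cases hk : bk k with
  | nil => simp [hk] at hu
  | cons v l =>
    obtain rfl : v = u := by simpa [hk] using hu
    have := hh.notMem_head (pathWord h W (bk k)) (W k)
    rw [hk, pathWord, hb.eq_past _ _ _ hk] at this
    intro e
    rw [pathColor, hk, pathWord, hb.eq_past _ _ _ hk] at e
    rw [e] at this
    simp [pathColor] at this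

/-- The probability that the sampler extends `x` by `a`. -/
noncomputable def stepProb (h : List (Fin 4) → I → Fin 4) (a : Fin 4) (x : List (Fin 4)) :
    ℝ≥0∞ := volume {w | h x w = a}

/-- When `D` contains all predecessors of its vertices, prescribing the colors on `D` restricts each
label in `D` separately, so the event is a product event. -/
theorem IsSampler.measure_of_closed {h : List (Fin 4) → I → Fin 4} (hh : IsSampler h)
    {bk : K → List K} (hb : IsPast bk) {D : Finset K} (hD : ∀ k ∈ D, ∀ u ∈ bk k, u ∈ D)
    (a : K → Fin 4) :
    iidUniform K {W | ∀ k ∈ D, pathColor h bk W k = a k} = pathWeight (stepProb h) bk D a := by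
  have hset : {W | ∀ k ∈ D, pathColor h bk W k = a k} =
      Set.pi (D : Set K) fun k => {w | h ((bk k).map a) w = a k} := by
    ext W
    simp only [Set.mem_ofPred_eq, Set.mem_pi, Finset.mem_coe]
    constructor
    · intro hW k hk
      rw [← hW k hk, pathColor, pathWord_past hb,
        List.map_congr_left fun i hi => hW i (hD k hk i hi)]
    · intro hW k hk
      induction hn : (bk k).length using Nat.strong_induction_on generalizing k with
      | _ n ih =>
        rw [pathColor, pathWord_past hb, List.map_congr_left fun i hi =>
          ih _ (hn ▸ hb.length_lt hi) i (hD k hk i hi) rfl]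
        exact hW k hk
  rw [hset, iidUniform, Measure.infinitePi_pi]
  · refine Finset.prod_congr rfl fun k hk => ?_
    have : pastWithin bk D k = bk k := by
      unfold pastWithin
      rw [List.takeWhile_eq_self_iff]
      simpa using hD k hk
    rw [this]
    rfl
  · exact fun k _ => hh.measurable _ (measurableSet_singleton _)

/-- The law of the random coloring along the paths, observed on a finite set. -/
theorem IsSampler.measure_pathColor {h : List (Fin 4) → I → Fin 4} (hh : IsSampler h)
    {bk : K → List K} (hb : IsPast bk) (S : Finset K) (a : K → Fin 4) :
    iidUniform K {W | ∀ k ∈ S, pathColor h bk W k = a k} = pathWeight (stepProb h) bk S a := by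
  classical
  -- The formula survives dropping one vertex: its color is summed out on both sides, by additivity
  -- and by `sum_pathWeight_update`.
  have step : ∀ (D : Finset K) (k : K),
      (∀ a : K → Fin 4, iidUniform K {W | ∀ k ∈ D, pathColor h bk W k = a k} =
        pathWeight (stepProb h) bk D a) →
      ∀ a : K → Fin 4, iidUniform K {W | ∀ j ∈ D.erase k, pathColor h bk W j = a j} =
        pathWeight (stepProb h) bk (D.erase k) a := by
    intro D k hD a
    by_cases hk : k ∈ D
    swap
    · rw [Finset.erase_eq_of_notMem hk]
      exact hD a
    rw [← sum_pathWeight_update (r := stepProb h) (fun a x => hh.volume_mul x a) hb hk a]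
    simp_rw [← hD]
    rw [← measure_biUnion_finset]
    · congr 1
      ext W
      simp only [Set.mem_ofPred_eq, Finset.mem_univ, Set.iUnion_true, Set.mem_iUnion]
      constructor
      · intro hW
        refine ⟨pathColor h bk W k, fun j hj => ?_⟩
        by_cases hjk : j = k
        · subst hjk; simp
        · rw [Function.update_of_ne hjk]
          exact hW j (Finset.mem_erase.2 ⟨hjk, hj⟩)
      · rintro ⟨c, hc⟩ j hj
        have := Finset.mem_erase.1 hj
        rw [hc j this.2, Function.update_of_ne this.1]
    · intro c _ c' _ hcc
      refine Set.disjoint_left.2 fun W h1 h2 => hcc ?_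
      have h1 := h1 k hk
      have h2 := h2 k hk
      rw [Function.update_self] at h1 h2
      rw [← h1, ← h2]
    · intro c _
      have : {W | ∀ j ∈ D, pathColor h bk W j = Function.update a k c j} =
          ⋂ j ∈ D, (fun W => pathColor h bk W j) ⁻¹' {Function.update a k c j} := by
        ext W; simp
      rw [this]
      exact Finset.measurableSet_biInter _ fun j _ =>
        hh.measurable_sample _ _ (measurableSet_singleton _)
  have key : ∀ (D R : Finset K),
      (∀ a : K → Fin 4, iidUniform K {W | ∀ k ∈ D, pathColor h bk W k = a k} =
        pathWeight (stepProb h) bk D a) →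
      ∀ a : K → Fin 4, iidUniform K {W | ∀ j ∈ D \ R, pathColor h bk W j = a j} =
        pathWeight (stepProb h) bk (D \ R) a := by
    intro D R hD
    induction R using Finset.induction_on with
    | empty => simpa using hD
    | insert k R _ ih =>
      rw [Finset.sdiff_insert]
      exact step _ k ih
  -- The closure of `S` under predecessors is finite; the vertices outside `S` are then dropped one
  -- at a time.
  let D : Finset K := S ∪ S.biUnion fun k => (bk k).toFinset
  have hS : D \ (D \ S) = S := by
    rw [Finset.sdiff_sdiff_eq_self]
    exact Finset.subset_union_left
  have := key D (D \ S) (fun a => hh.measure_of_closed hb ?_ a) a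
  · rwa [hS] at this
  · have htrans : ∀ k u v, u ∈ bk k → v ∈ bk u → v ∈ bk k := by
      intro k u v hu hv
      induction hn : bk k generalizing k with
      | nil => simp [hn] at hu
      | cons w l ih =>
        obtain rfl := hb.eq_past k w l hn
        rw [hn, List.mem_cons] at hu
        rcases hu with rfl | hu
        · exact List.mem_cons_of_mem _ hv
        · exact List.mem_cons_of_mem _ (ih w hu rfl)
    intro k hk u hu
    simp only [D, Finset.mem_union, Finset.mem_biUnion, List.mem_toFinset] at hk ⊢
    rcases hk with hk | ⟨j, hj, hk⟩
    · exact Or.inr ⟨k, hk, hu⟩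
    · exact Or.inr ⟨j, hj, htrans j k u hk hu⟩

end PathColoring

/-! ### Finite pasts of a relation -/

section PastLists

variable {K : Type*}

/-- Following the relation `R` backwards from the given vertex yields exactly the given finite list
of predecessors. -/
def IsPastList (R : K → K → Prop) : K → List K → Prop
  | k, [] => ∀ u, ¬ R u k
  | k, u :: l => R u k ∧ IsPastList R u l

theorem IsPastList.unique {R : K → K → Prop} (hR : ∀ u u' k, R u k → R u' k → u = u') {k : K}
    {l l' : List K} (h : IsPastList R k l) (h' : IsPastList R k l') : l = l' := by
  induction l generalizing k l' with
  | nil =>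
    cases l' with
    | nil => rfl
    | cons u' l' => exact absurd h'.1 (h u')
  | cons u l ih =>
    cases l' with
    | nil => exact absurd h.1 (h' u)
    | cons u' l' =>
      obtain rfl := hR _ _ _ h.1 h'.1
      rw [ih h.2 h'.2]

open Classical in
/-- The list of predecessors of a vertex, and the empty list if there are infinitely many. -/
noncomputable def pastList (R : K → K → Prop) (k : K) : List K :=
  if h : ∃ l, IsPastList R k l then h.choose else []

theorem IsPastList.pastList_eq {R : K → K → Prop} (hR : ∀ u u' k, R u k → R u' k → u = u') {k : K}
    {l : List K} (h : IsPastList R k l) : pastList R k = l := by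
  have h1 : ∃ l, IsPastList R k l := ⟨l, h⟩
  rw [pastList, dif_pos h1]
  exact h1.choose_spec.unique hR h

theorem isPastList_of_pastList_eq_cons {R : K → K → Prop} {k u : K} {l : List K}
    (h : pastList R k = u :: l) : IsPastList R k (u :: l) := by
  by_cases h1 : ∃ l, IsPastList R k l
  · rw [pastList, dif_pos h1] at h
    rw [← h]
    exact h1.choose_spec
  · simp [pastList, dif_neg h1] at h

theorem rel_of_mem_head_pastList {R : K → K → Prop} {k u : K} (h : u ∈ (pastList R k).head?) :
    R u k := by
  cases hk : pastList R k with
  | nil => simp [hk] at h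
  | cons v l =>
    obtain rfl : v = u := by simpa [hk] using h
    exact (isPastList_of_pastList_eq_cons hk).1

/-- No finiteness of pasts is needed: a nonempty `pastList` is a genuine past, and the default `[]`
satisfies both conditions vacuously. -/
theorem isPast_pastList {R : K → K → Prop} (hR : ∀ u u' k, R u k → R u' k → u = u')
    (hR' : ∀ u k k', R u k → R u k' → k = k') : IsPast (pastList R) where
  eq_past _ _ _ h := ((isPastList_of_pastList_eq_cons h).2.pastList_eq hR).symm
  head_injective _ _ u h h' := hR' u _ _ (rel_of_mem_head_pastList h) (rel_of_mem_head_pastList h')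

theorem mem_head_pastList {R : K → K → Prop} (hR : ∀ u u' k, R u k → R u' k → u = u') {k u : K}
    (hk : ∃ l, IsPastList R k l) : u ∈ (pastList R k).head? ↔ R u k := by
  refine ⟨rel_of_mem_head_pastList, fun h => ?_⟩
  obtain ⟨l, hl⟩ := hk
  rw [hl.pastList_eq hR]
  cases l with
  | nil => exact absurd h (hl u)
  | cons v l => simp [hR _ _ _ hl.1 h]

theorem isPastList_map {K' : Type*} {R : K → K → Prop} {R' : K' → K' → Prop} (e : K ≃ K')
    (he : ∀ u k, R u k ↔ R' (e u) (e k)) (k : K) (l : List K) :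
    IsPastList R' (e k) (l.map e) ↔ IsPastList R k l := by
  induction l generalizing k with
  | nil =>
    simp only [List.map_nil, IsPastList, he]
    exact e.surjective.forall
  | cons u l ih => simp only [List.map_cons, IsPastList, he, ih]

/-- Equivariance is compatible with the choice in `pastList` because a finite past is unique and an
infinite one has the fixed default. -/
theorem pastList_map {K' : Type*} {R : K → K → Prop} {R' : K' → K' → Prop} (e : K ≃ K')
    (he : ∀ u k, R u k ↔ R' (e u) (e k)) (hR' : ∀ u u' k, R' u k → R' u' k → u = u') (k : K) :
    pastList R' (e k) = (pastList R k).map e := by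
  have hR : ∀ u u' k, R u k → R u' k → u = u' := fun u u' k h h' =>
    e.injective (hR' _ _ _ ((he _ _).1 h) ((he _ _).1 h'))
  by_cases h : ∃ l, IsPastList R k l
  · obtain ⟨l, hl⟩ := h
    rw [hl.pastList_eq hR, ((isPastList_map e he k l).2 hl).pastList_eq hR']
  · have h' : ¬ ∃ l, IsPastList R' (e k) l := by
      rintro ⟨l, hl⟩
      obtain ⟨l, rfl⟩ := List.map_surjective_iff.2 e.surjective l
      exact h ⟨l, (isPastList_map e he k l).1 hl⟩
    rw [pastList, dif_neg h', pastList, dif_neg h, List.map_nil]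

theorem pathWord_map {K' : Type*} (h : List (Fin 4) → I → Fin 4) (e : K → K') (W : K' → I)
    (l : List K) : pathWord h (W ∘ e) l = pathWord h W (l.map e) := by
  induction l with
  | nil => rfl
  | cons k l ih => simp [pathWord, ih]

end PastLists

/-! ### Ranks, bits and the paths formed by each class of edges -/

section Ranks

variable {V : Type*} (G : SimpleGraph V) (d : ℕ) (U : V → I)

/-- The rank of `w` among the neighbors of `v` in the order given by the labels. -/
noncomputable def nbrRank (v w : V) : ℕ := {x | G.Adj v x ∧ U x < U w}.ncard

open Classical in
/-- For each rank, whether the neighbor of that rank has a larger label. -/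
noncomputable def upBits (v : V) : Fin d → Bool :=
  fun i => decide (∃ w, G.Adj v w ∧ nbrRank G U v w = i ∧ U v < U w)

/-- The neighbors of `v` have distinct labels. -/
def TieFree (v : V) : Prop := ∀ x y, G.Adj v x → G.Adj v y → U x = U y → x = y

/-- Classes of edges: unordered pairs of distinct ranks. -/
abbrev RankPair (d : ℕ) := {c : Sym2 (Fin d) // ¬ c.IsDiag}

/-- The edges that the bits do not color properly, in each class, directed towards the larger
label. -/
def IsStep (p q : V × RankPair d) : Prop :=
  p.2 = q.2 ∧ G.Adj p.1 q.1 ∧ U p.1 < U q.1 ∧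
    s(nbrRank G U p.1 q.1, nbrRank G U q.1 p.1) = (q.2 : Sym2 (Fin d)).map Fin.val ∧
    upBits G d U p.1 = upBits G d U q.1 ∧ TieFree G U p.1 ∧ TieFree G U q.1

variable {G d U}

theorem finite_nbr_lt [G.LocallyFinite] (v w : V) : {x | G.Adj v x ∧ U x < U w}.Finite :=
  (Set.toFinite (G.neighborSet v)).subset fun _ h => h.1

theorem nbrRank_lt [G.LocallyFinite] (hd : ∀ v, G.degree v ≤ d) {v w : V} (h : G.Adj v w) :
    nbrRank G U v w < d := by
  refine lt_of_lt_of_le ?_ (hd v)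
  rw [← G.card_neighborFinset_eq_degree, ← Set.ncard_coe_finset, nbrRank]
  refine Set.ncard_lt_ncard ⟨fun x hx => by simpa using hx.1, fun hs => ?_⟩
  have : w ∈ (G.neighborFinset v : Set V) := by simpa using h
  exact lt_irrefl _ (hs this).2

theorem TieFree.nbrRank_injective [G.LocallyFinite] {v w w' : V} (hv : TieFree G U v)
    (hw : G.Adj v w) (hw' : G.Adj v w') (h : nbrRank G U v w = nbrRank G U v w') : w = w' := by
  have key : ∀ w w', G.Adj v w → U w < U w' → nbrRank G U v w < nbrRank G U v w' := by
    intro w w' hw hlt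
    refine Set.ncard_lt_ncard ⟨fun x hx => ⟨hx.1, hx.2.trans hlt⟩, fun hs => ?_⟩
      (finite_nbr_lt v w')
    exact lt_irrefl _ (hs (show w ∈ {x | G.Adj v x ∧ U x < U w'} from ⟨hw, hlt⟩)).2
  rcases lt_trichotomy (U w) (U w') with h1 | h1 | h1
  · exact absurd h (key w w' hw h1).ne
  · exact hv w w' hw hw' h1
  · exact absurd h (key w' w hw' h1).ne'

theorem upBits_eq_true {v w : V} {i : Fin d} (hw : G.Adj v w) (hi : nbrRank G U v w = i)
    (h : U v < U w) : upBits G d U v i = true := by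
  simp only [upBits, decide_eq_true_eq]
  exact ⟨w, hw, hi, h⟩

theorem TieFree.upBits_eq_false [G.LocallyFinite] {v w : V} (hv : TieFree G U v) {i : Fin d}
    (hw : G.Adj v w) (hi : nbrRank G U v w = i) (h : U w < U v) : upBits G d U v i = false := by
  simp only [upBits, decide_eq_false_iff_not]
  rintro ⟨w', hw', hi', h'⟩
  obtain rfl := hv.nbrRank_injective hw hw' (hi.trans hi'.symm)
  exact lt_asymm h h'

/-- Suppose two predecessors have different ranks at `q`. Since their edges have the same class, the
rank of `q` at `p` equals the rank of `p'` at `q`. The bit at that rank is true at `p`, as `q` is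
larger, and false at `q`, as `p'` is smaller, although `p` and `q` have equal bits. -/
theorem IsStep.eq_left [G.LocallyFinite] (hd : ∀ v, G.degree v ≤ d) {p p' q : V × RankPair d}
    (h : IsStep G d U p q) (h' : IsStep G d U p' q) : p = p' := by
  obtain ⟨h1, h2, h3, h4, h5, h6, h7⟩ := h
  obtain ⟨h1', h2', h3', h4', h5', h6', -⟩ := h'
  refine Prod.ext ?_ (h1.trans h1'.symm)
  by_cases hr : nbrRank G U q.1 p.1 = nbrRank G U q.1 p'.1
  · exact h7.nbrRank_injective h2.symm h2'.symm hr
  · exfalso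
    rw [← h4, Sym2.eq_iff] at h4'
    have h8 : nbrRank G U p.1 q.1 = nbrRank G U q.1 p'.1 := by
      rcases h4' with h | h
      · exact absurd h.2.symm hr
      · exact h.2.symm
    let i : Fin d := ⟨nbrRank G U q.1 p'.1, nbrRank_lt hd h2'.symm⟩
    have e1 := upBits_eq_true (i := i) h2 h8 h3
    have e2 := h7.upBits_eq_false (i := i) h2'.symm rfl h3'
    rw [h5, e2] at e1
    exact Bool.false_ne_true e1

theorem IsStep.eq_right [G.LocallyFinite] (hd : ∀ v, G.degree v ≤ d) {p q q' : V × RankPair d}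
    (h : IsStep G d U p q) (h' : IsStep G d U p q') : q = q' := by
  obtain ⟨h1, h2, h3, h4, h5, h6, h7⟩ := h
  obtain ⟨h1', h2', h3', h4', h5', -, h7'⟩ := h'
  have hc : q.2 = q'.2 := h1.symm.trans h1'
  refine Prod.ext ?_ hc
  by_cases hr : nbrRank G U p.1 q.1 = nbrRank G U p.1 q'.1
  · exact h6.nbrRank_injective h2 h2' hr
  · exfalso
    rw [← hc, ← h4, Sym2.eq_iff] at h4'
    have h8 : nbrRank G U q.1 p.1 = nbrRank G U p.1 q'.1 := by
      rcases h4' with h | h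
      · exact absurd h.1.symm hr
      · exact h.1.symm
    let i : Fin d := ⟨nbrRank G U p.1 q'.1, nbrRank_lt hd h2'⟩
    have e1 := upBits_eq_true (i := i) h2' rfl h3'
    have e2 := h7.upBits_eq_false (i := i) h2.symm h8 h3
    rw [h5, e2] at e1
    exact Bool.false_ne_true e1

/-- Adjacent vertices with the same bits are joined by an edge in some class. -/
theorem exists_isStep [G.LocallyFinite] (hd : ∀ v, G.degree v ≤ d) {u v : V} (h : G.Adj u v)
    (hu : TieFree G U u) (hv : TieFree G U v) (hlt : U u < U v)
    (hb : upBits G d U u = upBits G d U v) : ∃ c, IsStep G d U (u, c) (v, c) := by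
  let i : Fin d := ⟨nbrRank G U u v, nbrRank_lt hd h⟩
  let j : Fin d := ⟨nbrRank G U v u, nbrRank_lt hd h.symm⟩
  -- At a common rank, the bit would be true at `u` and false at `v`.
  have hij : i ≠ j := by
    intro e
    have e1 := upBits_eq_true (i := i) h rfl hlt
    have e2 := hv.upBits_eq_false (i := i) h.symm (by rw [e]) hlt
    rw [hb, e2] at e1
    exact Bool.false_ne_true e1
  exact ⟨⟨s(i, j), by simpa using hij⟩, rfl, h, hlt, rfl, hb, hu, hv⟩

theorem nbrRank_comp (φ : G ≃g G) (v w : V) :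
    nbrRank G (U ∘ φ) v w = nbrRank G U (φ v) (φ w) := by
  rw [nbrRank, nbrRank, ← Set.ncard_image_of_injective _ φ.injective]
  congr 1
  ext y
  obtain ⟨x, rfl⟩ := φ.surjective y
  simp [φ.map_adj_iff]

theorem upBits_comp (φ : G ≃g G) (v : V) : upBits G d (U ∘ φ) v = upBits G d U (φ v) := by
  funext i
  simp only [upBits, nbrRank_comp, decide_eq_decide]
  constructor
  · rintro ⟨w, h1, h2, h3⟩
    exact ⟨φ w, φ.map_adj_iff.2 h1, h2, h3⟩
  · rintro ⟨w, h1, h2, h3⟩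
    obtain ⟨x, rfl⟩ := φ.surjective w
    exact ⟨x, φ.map_adj_iff.1 h1, h2, h3⟩

theorem tieFree_comp (φ : G ≃g G) (v : V) : TieFree G (U ∘ φ) v ↔ TieFree G U (φ v) := by
  constructor
  · intro h x y hx hy e
    obtain ⟨x, rfl⟩ := φ.surjective x
    obtain ⟨y, rfl⟩ := φ.surjective y
    rw [h x y (φ.map_adj_iff.1 hx) (φ.map_adj_iff.1 hy) e]
  · intro h x y hx hy e
    exact φ.injective (h _ _ (φ.map_adj_iff.2 hx) (φ.map_adj_iff.2 hy) e)

theorem isStep_comp (φ : G ≃g G) (p q : V × RankPair d) :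
    IsStep G d (U ∘ φ) p q ↔ IsStep G d U (φ p.1, p.2) (φ q.1, q.2) := by
  simp only [IsStep, nbrRank_comp, upBits_comp, tieFree_comp, φ.map_adj_iff, Function.comp_apply]

theorem nbrRank_congr {U' : V → I} {v w : V} (hw : G.Adj v w)
    (h : ∀ x y, G.Adj v x → G.Adj v y → (U x < U y ↔ U' x < U' y)) :
    nbrRank G U v w = nbrRank G U' v w := by
  unfold nbrRank
  congr 1
  ext x
  simp only [Set.mem_ofPred_eq]
  exact and_congr_right fun hx => h x w hx hw

/-- The set `T` contains the vertex `v` and its neighbors. -/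
def ContainsClosedNbhd (G : SimpleGraph V) (T : Set V) (v : V) : Prop :=
  v ∈ T ∧ ∀ w, G.Adj v w → w ∈ T

theorem upBits_congr {U' : V → I} {T : Set V} {v : V} (hv : ContainsClosedNbhd G T v)
    (h : ∀ x ∈ T, ∀ y ∈ T, (U x < U y ↔ U' x < U' y)) :
    upBits G d U v = upBits G d U' v := by
  funext i
  simp only [upBits, decide_eq_decide]
  refine exists_congr fun w => and_congr_right fun hw => ?_
  rw [nbrRank_congr hw fun x y hx hy => h x (hv.2 x hx) y (hv.2 y hy),
    h v hv.1 w (hv.2 w hw)]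

theorem tieFree_congr {U' : V → I} {T : Set V} {v : V} (hv : ContainsClosedNbhd G T v)
    (h : ∀ x ∈ T, ∀ y ∈ T, (U x < U y ↔ U' x < U' y)) : TieFree G U v ↔ TieFree G U' v := by
  refine forall₄_congr fun x y hx hy => ?_
  have h1 := h x (hv.2 x hx) y (hv.2 y hy)
  have h2 := h y (hv.2 y hy) x (hv.2 x hx)
  rw [le_antisymm_iff (a := U x), le_antisymm_iff (a := U' x), ← not_lt, ← not_lt,
    ← not_lt, ← not_lt, h1, h2]

/-- Being a step is decided by comparing labels within the two closed neighborhoods. Measurability,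
locality and the finitary property all rest on this. -/
theorem isStep_congr {U' : V → I} {T : Set V} {p q : V × RankPair d}
    (hp : ContainsClosedNbhd G T p.1) (hq : ContainsClosedNbhd G T q.1)
    (h : ∀ x ∈ T, ∀ y ∈ T, (U x < U y ↔ U' x < U' y)) :
    IsStep G d U p q ↔ IsStep G d U' p q := by
  refine and_congr_right fun _ => and_congr_right fun hpq => ?_
  rw [h _ hp.1 _ hq.1, upBits_congr hp h, upBits_congr hq h, tieFree_congr hp h,
    tieFree_congr hq h,
    nbrRank_congr hpq fun x y hx hy => h x (hp.2 x hx) y (hp.2 y hy),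
    nbrRank_congr hpq.symm fun x y hx hy => h x (hq.2 x hx) y (hq.2 y hy)]

theorem pairwise_lt_of_isChain {U : V → I} {l : List (V × RankPair d)}
    (h : l.IsChain fun q p => IsStep G d U p q) :
    (l.map Prod.fst).Pairwise fun x y => U y < U x := by
  have : l.Pairwise fun q p => U p.1 < U q.1 := by
    have : IsTrans (V × RankPair d) (fun q p => U p.1 < U q.1) :=
      ⟨fun a b c h1 h2 => lt_trans h2 h1⟩
    exact List.isChain_iff_pairwise.1 (h.imp fun _ _ h => h.2.2.1)
  exact List.pairwise_map.2 this

theorem isStep_left_unique [G.LocallyFinite] (hd : ∀ v, G.degree v ≤ d) (U : V → I) :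
    ∀ p p' q : V × RankPair d, IsStep G d U p q → IsStep G d U p' q → p = p' :=
  fun _ _ _ => IsStep.eq_left hd

theorem isStep_right_unique [G.LocallyFinite] (hd : ∀ v, G.degree v ≤ d) (U : V → I) :
    ∀ p q q' : V × RankPair d, IsStep G d U p q → IsStep G d U p q' → q = q' :=
  fun _ _ _ => IsStep.eq_right hd

theorem isPast_isStep [G.LocallyFinite] (hd : ∀ v, G.degree v ≤ d) (U : V → I) :
    IsPast (pastList (IsStep G d U)) :=
  isPast_pastList (isStep_left_unique hd U) (isStep_right_unique hd U)

end Ranks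

/-! ### Families of iid uniform labels -/

section Labels

variable {V : Type*}

instance : IsProbabilityMeasure (iidUniform V) := by unfold iidUniform; infer_instance

theorem map_iidUniform_comp {ι : Type*} {f : ι → V} (hf : Function.Injective f) :
    (iidUniform V).map (fun U => U ∘ f) = iidUniform ι := by
  classical
  refine Measure.eq_infinitePi _ fun s t ht => ?_
  have hm : Measurable fun U : V → I => U ∘ f :=
    measurable_pi_lambda _ fun i => measurable_pi_apply (f i)
  rw [Measure.map_apply hm (.pi s.countable_toSet fun _ _ => ht _)]
  rcases isEmpty_or_nonempty ι with hι | hι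
  · have : s = ∅ := Finset.eq_empty_of_isEmpty s
    simp [this]
  have : (fun U : V → I => U ∘ f) ⁻¹' (Set.pi s t) =
      Set.pi (s.image f : Finset V) fun x => t (Function.invFun f x) := by
    ext U
    simp [Set.mem_pi, Function.leftInverse_invFun hf _]
  rw [this, iidUniform, Measure.infinitePi_pi _ fun i _ => ht _, Finset.prod_image hf.injOn]
  simp [Function.leftInverse_invFun hf _]

theorem ae_ne_iidUniform {x y : V} (h : x ≠ y) : ∀ᵐ U ∂iidUniform V, U x ≠ U y := by
  have hm : Measurable fun U : V → I => (U x, U y) := by fun_prop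
  have h1 : (iidUniform V).map (fun U => (U x, U y)) = (volume : Measure I).prod volume :=
    Measure.infinitePi_map_eval_prod h
  have h2 : ∀ᵐ p ∂(iidUniform V).map (fun U => (U x, U y)), p.1 ≠ p.2 := by
    rw [h1, Measure.ae_prod_iff_ae_ae]
    · refine Filter.Eventually.of_forall fun a => ?_
      have : ∀ᵐ b : I, b ≠ a := by simp [ae_iff]
      filter_upwards [this] with b hb using hb.symm
    · exact (measurableSet_eq_fun measurable_fst measurable_snd).compl
  exact ae_of_ae_map hm.aemeasurable h2

/-- The `m!` events that a given rearrangement of the labels is decreasing are disjoint and, by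
exchangeability, equally likely. -/
theorem factorial_mul_strictAnti_le {m : ℕ} :
    m.factorial * iidUniform (Fin m) {y | StrictAnti y} ≤ 1 := by
  have hmeas : MeasurableSet {y : Fin m → I | StrictAnti y} := by
    have : {y : Fin m → I | StrictAnti y} = ⋂ i, ⋂ j, ⋂ _ : i < j, {y | y j < y i} := by
      ext y; simp [StrictAnti]
    rw [this]
    exact MeasurableSet.iInter fun i => MeasurableSet.iInter fun j => MeasurableSet.iInter fun _ =>
      measurableSet_lt (measurable_pi_apply j) (measurable_pi_apply i)
  have hm : ∀ ρ : Equiv.Perm (Fin m), Measurable fun y : Fin m → I => y ∘ ρ :=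
    fun ρ => measurable_pi_lambda _ fun i => measurable_pi_apply (ρ i)
  have h1 : ∀ ρ : Equiv.Perm (Fin m),
      iidUniform (Fin m) ((fun y : Fin m → I => y ∘ ρ) ⁻¹' {y | StrictAnti y}) =
        iidUniform (Fin m) {y | StrictAnti y} := by
    intro ρ
    rw [← Measure.map_apply (hm ρ) hmeas, map_iidUniform_comp ρ.injective]
  calc m.factorial * iidUniform (Fin m) {y | StrictAnti y}
      = ∑ ρ : Equiv.Perm (Fin m),
          iidUniform (Fin m) ((fun y : Fin m → I => y ∘ ρ) ⁻¹' {y | StrictAnti y}) := by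
        simp_rw [h1]
        simp [Fintype.card_perm]
    _ = iidUniform (Fin m) (⋃ ρ ∈ (Finset.univ : Finset (Equiv.Perm (Fin m))),
          (fun y : Fin m → I => y ∘ ρ) ⁻¹' {y | StrictAnti y}) := by
        rw [measure_biUnion_finset]
        · intro ρ _ τ _ hne
          refine Set.disjoint_left.2 fun y hρ hτ => hne ?_
          have hρ : StrictAnti (y ∘ ρ) := hρ
          have hτ : StrictAnti (y ∘ τ) := hτ
          have hmono : StrictMono (ρ.trans τ.symm) := by
            intro i j hij
            refine hτ.lt_iff_gt.1 ?_
            simpa using hρ hij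
          have hid : (ρ.trans τ.symm : Fin m → Fin m) = id :=
            (hmono.range_inj strictMono_id).1 (by simp [Set.range_eq_univ.2 (Equiv.surjective _)])
          ext i
          have := congrFun hid i
          simp only [Equiv.trans_apply, id_eq, Equiv.symm_apply_eq] at this
          rw [this]
        · exact fun ρ _ => hm ρ hmeas
    _ ≤ 1 := prob_le_one

theorem measure_pairwise_gt_le (l : List V) :
    l.length.factorial * iidUniform V {U | l.Pairwise fun x y => U y < U x} ≤ 1 := by
  by_cases hl : l.Nodup
  · have hm : Measurable fun U : V → I => U ∘ l.get :=
      measurable_pi_lambda _ fun i => measurable_pi_apply _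
    refine le_trans ?_ (factorial_mul_strictAnti_le (m := l.length))
    rw [← map_iidUniform_comp (List.nodup_iff_injective_get.1 hl)]
    gcongr
    refine le_trans (measure_mono ?_) (Measure.le_map_apply hm.aemeasurable _)
    intro U hU i j hij
    exact List.pairwise_iff_get.1 hU i j hij
  · have : {U : V → I | l.Pairwise fun x y => U y < U x} = ∅ := by
      refine Set.eq_empty_of_forall_notMem fun U hU => hl ?_
      refine List.Pairwise.imp (fun {x y} h => ?_) hU
      rintro rfl
      exact lt_irrefl _ h
    simp [this]

end Labels

/-! ### Functions of the order pattern of finitely many labels -/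

section OrderPattern

variable {V : Type*} {Z : Type*} [MeasurableSpace Z] [Nonempty Z]

/-- A function of the order pattern of finitely many labels is measurable. -/
theorem exists_measurable_of_order_pattern (T : Finset V) (A : Set (V → I)) (g : (V → I) → Z)
    (h : ∀ U ∈ A, ∀ U' ∈ A, (∀ x ∈ T, ∀ y ∈ T, (U x < U y ↔ U' x < U' y)) → g U = g U') :
    ∃ g' : (T → I) → Z, Measurable g' ∧ ∀ U ∈ A, g U = g' (fun x => U x) := by
  -- The order pattern is a measurable function with values in a finite type, so everything computed
  -- from it is measurable, even if `A` is not.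
  let π : (T → I) → (T → T → Prop) := fun y i j => y i < y j
  have hπ : Measurable π := measurable_pi_lambda _ fun i => measurable_pi_lambda _ fun j =>
    measurableSet_setOfPred.1 (measurableSet_lt (measurable_pi_apply i) (measurable_pi_apply j))
  let G : A → Z := fun U => g U
  let P : A → (T → T → Prop) := fun U => π fun x => (U : V → I) x
  have hf : Function.FactorsThrough G P := by
    intro U U' e
    refine h U U.2 U' U'.2 fun x hx y hy => ?_
    exact iff_of_eq (congrFun (congrFun e ⟨x, hx⟩) ⟨y, hy⟩)
  refine ⟨fun y => Function.extend P G (fun _ => Classical.arbitrary Z) (π y),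
    (measurable_of_finite
      (Function.extend P G fun _ => Classical.arbitrary Z)).comp hπ, fun U hU => ?_⟩
  exact (hf.extend_apply (fun _ => Classical.arbitrary Z) ⟨U, hU⟩).symm

theorem measurable_of_order_pattern (T : Finset V) (g : (V → I) → Z)
    (h : ∀ U U' : V → I, (∀ x ∈ T, ∀ y ∈ T, (U x < U y ↔ U' x < U' y)) → g U = g U') :
    Measurable g := by
  obtain ⟨g', hg', e⟩ := exists_measurable_of_order_pattern T Set.univ g
    fun U _ U' _ => h U U'
  have : g = fun U => g' (fun x => U x) := funext fun U => e U trivial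
  rw [this]
  exact hg'.comp (measurable_pi_lambda _ fun x => measurable_pi_apply _)

end OrderPattern

/-! ### Splitting one label into several -/

section Extraction

/-- Each label can be split into independent uniform labels. -/
theorem exists_split_label (C : Type) [Countable C] :
    ∃ f : I → C → I, Measurable f ∧ (volume : Measure I).map f = iidUniform C :=
  Measure.exists_measurable_map_eq (iidUniform C)

/-- The coordinate `none` supplies the ordering label and `some c` the sampling label of class `c`.
The pair has the law of two independent iid families, which allows conditioning on the ordering by
Fubini. -/
theorem map_split_label {V C : Type*} {f : I → Option C → I} (hf : Measurable f)
    (hf' : (volume : Measure I).map f = iidUniform (Option C)) :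
    (iidUniform V).map (fun ω => ((fun v => f (ω v) none),
      (fun k : V × C => f (ω k.1) (some k.2)))) = (iidUniform V).prod (iidUniform (V × C)) := by
  have hm : Measurable fun (ω : V → I) (p : V × Option C) => f (ω p.1) p.2 :=
    measurable_pi_lambda _ fun p =>
      (measurable_pi_apply p.2).comp (hf.comp (measurable_pi_apply p.1))
  have h1 : (iidUniform V).map (fun ω (p : V × Option C) => f (ω p.1) p.2) =
      iidUniform (V × Option C) := by
    have h2 := Measure.infinitePi_map_pi (fun _ : V => (volume : Measure I)) (f := fun _ => f)
      fun _ => hf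
    have h3 := Measure.infinitePi_map_curry_symm
      (fun (_ : V) (_ : Option C) => (volume : Measure I))
    rw [iidUniform, iidUniform, ← h3]
    simp only [hf', iidUniform] at h2
    rw [← h2, Measure.map_map]
    · rfl
    · fun_prop
    · fun_prop
  let e : (V × Option C → I) → (V → I) × (V × C → I) :=
    fun y => (fun v => y (v, none), fun k => y (k.1, some k.2))
  have he : Measurable e := by
    refine Measurable.prodMk ?_ ?_ <;>
    exact measurable_pi_lambda _ fun _ => measurable_pi_apply _
  -- `e'` merges two families into one and `e` separates them again, so it is enough to identify the
  -- law of the merged family.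
  let e' : (V → I) × (V × C → I) → (V × Option C → I) :=
    fun z p => p.2.elim (z.1 p.1) fun c => z.2 (p.1, c)
  have he' : Measurable e' := by
    refine measurable_pi_lambda _ fun p => ?_
    rcases p with ⟨v, _ | c⟩
    · exact (measurable_pi_apply v).comp measurable_fst
    · exact (measurable_pi_apply (v, c)).comp measurable_snd
  have h2 : ((iidUniform V).prod (iidUniform (V × C))).map e' = iidUniform (V × Option C) := by
    classical
    refine Measure.eq_infinitePi _ fun s t ht => ?_
    rw [Measure.map_apply he' (.pi s.countable_toSet fun _ _ => ht _)]
    let j1 : V ↪ V × Option C := ⟨fun v => (v, none), fun a b h => congrArg Prod.fst h⟩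
    let j2 : V × C ↪ V × Option C :=
      ⟨fun k => (k.1, some k.2), fun a b h => by simpa [Prod.ext_iff] using h⟩
    have hj1 : ∀ v, j1 v = (v, none) := fun _ => rfl
    have hj2 : ∀ k, j2 k = (k.1, some k.2) := fun _ => rfl
    let s1 : Finset V := s.preimage j1 j1.injective.injOn
    let s2 : Finset (V × C) := s.preimage j2 j2.injective.injOn
    have hs1 : ∀ v, v ∈ s1 ↔ (v, none) ∈ s := fun v => Finset.mem_preimage
    have hs2 : ∀ k, k ∈ s2 ↔ (k.1, some k.2) ∈ s := fun k => Finset.mem_preimage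
    have hpre : e' ⁻¹' Set.pi s t = (Set.pi (s1 : Set V) fun v => t (v, none)) ×ˢ
        (Set.pi (s2 : Set (V × C)) fun k => t (k.1, some k.2)) := by
      ext z
      simp only [Set.mem_preimage, Set.mem_pi, Finset.mem_coe, Set.mem_prod, hs1, hs2]
      constructor
      · exact fun h => ⟨fun v hv => h _ hv, fun k hk => h _ hk⟩
      · rintro ⟨ha, hb⟩ ⟨v, _ | c⟩ hp
        · exact ha v hp
        · exact hb (v, c) hp
    rw [hpre, Measure.prod_prod, iidUniform, iidUniform, Measure.infinitePi_pi _ fun _ _ => ht _,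
      Measure.infinitePi_pi _ fun _ _ => ht _]
    have hs : s = s1.map j1 ∪ s2.map j2 := by
      ext ⟨v, _ | c⟩ <;> simp [hs1, hs2, hj1, hj2]
    conv_rhs => rw [hs]
    rw [Finset.prod_union, Finset.prod_map, Finset.prod_map]
    · rfl
    · rw [Finset.disjoint_left]
      simp [hj1, hj2]
  have h3 : (fun ω : V → I => ((fun v => f (ω v) none),
      (fun k : V × C => f (ω k.1) (some k.2)))) = e ∘ fun ω p => f (ω p.1) p.2 := rfl
  rw [h3, ← Measure.map_map he hm, h1, ← h2, Measure.map_map he he']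
  exact Measure.map_id

end Extraction

/-! ### Almost sure finiteness and measurability of pasts -/

section Steps

variable {V : Type*} {G : SimpleGraph V} [G.LocallyFinite] {d : ℕ}

open Classical in
/-- The lists of length `n` that can arise as chains of predecessors of `k`. -/
noncomputable def predLists (G : SimpleGraph V) [G.LocallyFinite] {C : Type*} :
    ℕ → V × C → Finset (List (V × C))
  | 0, _ => {[]}
  | n + 1, k => (G.neighborFinset k.1).biUnion fun w =>
      (predLists G n (w, k.2)).image ((w, k.2) :: ·)

theorem card_predLists_le (hd : ∀ v, G.degree v ≤ d) {C : Type*} (n : ℕ) (k : V × C) :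
    (predLists G n k).card ≤ d ^ n := by
  classical
  induction n generalizing k with
  | zero => simp [predLists]
  | succ n ih =>
    rw [predLists, pow_succ']
    refine (Finset.card_biUnion_le_card_mul _ _ (d ^ n) fun w _ =>
      Finset.card_image_le.trans (ih _)).trans ?_
    rw [G.card_neighborFinset_eq_degree]
    exact Nat.mul_le_mul_right _ (hd _)

theorem length_of_mem_predLists {C : Type*} {n : ℕ} {k : V × C} {l : List (V × C)}
    (h : l ∈ predLists G n k) : l.length = n := by
  classical
  induction n generalizing k l with
  | zero => simp_all [predLists]
  | succ n ih =>
    simp only [predLists, Finset.mem_biUnion, Finset.mem_image] at h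
    obtain ⟨w, -, l, hl, rfl⟩ := h
    simp [ih hl]

theorem mem_predLists_of_isChain {U : V → I} {k : V × RankPair d} {l : List (V × RankPair d)}
    (h : (k :: l).IsChain fun q p => IsStep G d U p q) : l ∈ predLists G l.length k := by
  induction l generalizing k with
  | nil => simp [predLists]
  | cons u l ih =>
    rw [List.isChain_cons_cons] at h
    simp only [List.length_cons, predLists, Finset.mem_biUnion, Finset.mem_image,
      SimpleGraph.mem_neighborFinset]
    have hu : (u.1, k.2) = u := by rw [← h.1.1]
    exact ⟨u.1, h.1.2.1.symm, l, by rw [hu]; exact ih h.2, by rw [hu]⟩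

theorem IsPastList.isChain {K : Type*} {R : K → K → Prop} {k : K} {l : List K}
    (h : IsPastList R k l) : (k :: l).IsChain fun q p => R p q := by
  induction l generalizing k with
  | nil => simp
  | cons u l ih => exact List.isChain_cons_cons.2 ⟨h.1, ih h.2⟩

theorem exists_isChain_of_not_isPastList {K : Type*} {R : K → K → Prop} {k : K}
    (h : ¬ ∃ l, IsPastList R k l) (n : ℕ) :
    ∃ l, l.length = n ∧ (k :: l).IsChain fun q p => R p q := by
  induction n generalizing k with
  | zero => exact ⟨[], rfl, by simp⟩
  | succ n ih =>
    obtain ⟨u, hu⟩ : ∃ u, R u k := by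
      by_contra hc
      push Not at hc
      exact h ⟨[], hc⟩
    obtain ⟨l, hl, hc⟩ := ih (k := u) fun ⟨l, hl⟩ => h ⟨u :: l, hu, hl⟩
    exact ⟨u :: l, by simp [hl], List.isChain_cons_cons.2 ⟨hu, hc⟩⟩

/-- Almost surely, following steps backwards ends after finitely many steps. -/
theorem ae_exists_isPastList (hd : ∀ v, G.degree v ≤ d) (k : V × RankPair d) :
    ∀ᵐ U ∂iidUniform V, ∃ l, IsPastList (IsStep G d U) k l := by
  rw [ae_iff]
  -- An endless past contains a chain of `n` steps for every `n`. There are at most `d ^ n`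
  -- candidates, and each requires `n + 1` decreasing labels, which has probability at most `1 / (n
  -- + 1)!`; the weaker `1 / n!` is enough.
  have hbound : ∀ n : ℕ, iidUniform V {U | ¬ ∃ l, IsPastList (IsStep G d U) k l} ≤
      ENNReal.ofReal ((d : ℝ) ^ n / n.factorial) := by
    intro n
    have h1 : ∀ l ∈ predLists G n k, iidUniform V
        {U | ((k :: l).map Prod.fst).Pairwise fun x y => U y < U x} ≤
          ((n.factorial : ℕ) : ℝ≥0∞)⁻¹ := by
      intro l hl
      have := measure_pairwise_gt_le ((k :: l).map Prod.fst)
      rw [mul_comm] at this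
      refine (ENNReal.le_inv_iff_mul_le.2 this).trans ?_
      rw [ENNReal.inv_le_inv]
      simp only [List.length_map, List.length_cons, length_of_mem_predLists hl]
      exact_mod_cast Nat.factorial_le (Nat.le_succ n)
    calc iidUniform V {U | ¬ ∃ l, IsPastList (IsStep G d U) k l}
        ≤ iidUniform V (⋃ l ∈ predLists G n k,
            {U | ((k :: l).map Prod.fst).Pairwise fun x y => U y < U x}) := by
          refine measure_mono fun U hU => ?_
          obtain ⟨l, hl, hc⟩ := exists_isChain_of_not_isPastList hU n
          exact Set.mem_biUnion (hl ▸ mem_predLists_of_isChain hc) (pairwise_lt_of_isChain hc)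
      _ ≤ ∑ l ∈ predLists G n k, ((n.factorial : ℕ) : ℝ≥0∞)⁻¹ :=
          (measure_biUnion_finset_le _ _).trans (Finset.sum_le_sum h1)
      _ ≤ (d : ℝ≥0∞) ^ n * ((n.factorial : ℕ) : ℝ≥0∞)⁻¹ := by
          rw [Finset.sum_const, nsmul_eq_mul]
          gcongr
          exact_mod_cast card_predLists_le hd n k
      _ = ENNReal.ofReal ((d : ℝ) ^ n / n.factorial) := by
          rw [ENNReal.ofReal_div_of_pos (by positivity), ENNReal.ofReal_pow (by positivity),
            ENNReal.ofReal_natCast, ENNReal.ofReal_natCast, div_eq_mul_inv]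
  have hlim : Filter.Tendsto (fun n : ℕ => ENNReal.ofReal ((d : ℝ) ^ n / n.factorial))
      Filter.atTop (nhds 0) := by
    have := ENNReal.tendsto_ofReal (FloorSemiring.tendsto_pow_div_factorial_atTop (d : ℝ))
    simpa using this
  exact le_antisymm (ge_of_tendsto' hlim hbound) (zero_le)

theorem ae_tieFree (v : V) : ∀ᵐ U ∂iidUniform V, TieFree G U v := by
  have : ∀ᵐ U ∂iidUniform V, ∀ x : G.neighborSet v, ∀ y : G.neighborSet v,
      (x : V) ≠ y → U x ≠ U y := by
    refine ae_all_iff.2 fun x => ae_all_iff.2 fun y => ?_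
    by_cases h : (x : V) = y
    · exact Filter.Eventually.of_forall fun U hne => absurd h hne
    · exact (ae_ne_iidUniform h).mono fun U hU _ => hU
  filter_upwards [this] with U hU x y hx hy e
  by_contra hne
  exact hU ⟨x, hx⟩ ⟨y, hy⟩ hne e

open Classical in
/-- A vertex together with its neighbors. -/
noncomputable def closedNbhd (G : SimpleGraph V) [G.LocallyFinite] (v : V) : Finset V :=
  insert v (G.neighborFinset v)

theorem containsClosedNbhd_of_subset {v : V} {T : Finset V} (h : closedNbhd G v ⊆ T) :
    ContainsClosedNbhd G (T : Set V) v :=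
  ⟨h (by simp [closedNbhd]), fun w hw => h (by simp [closedNbhd, hw])⟩

theorem measurable_upBits (v : V) : Measurable fun U : V → I => upBits G d U v :=
  measurable_of_order_pattern (closedNbhd G v) _ fun _ _ h =>
    upBits_congr (containsClosedNbhd_of_subset subset_rfl) h

theorem measurableSet_isStep (p q : V × RankPair d) :
    MeasurableSet {U : V → I | IsStep G d U p q} := by
  classical
  refine measurableSet_setOfPred.2 (measurable_of_order_pattern
    (closedNbhd G p.1 ∪ closedNbhd G q.1) _ fun U U' h => propext ?_)
  exact isStep_congr (containsClosedNbhd_of_subset Finset.subset_union_left)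
    (containsClosedNbhd_of_subset Finset.subset_union_right) h

theorem measurableSet_isPastList (k : V × RankPair d) (l : List (V × RankPair d)) :
    MeasurableSet {U : V → I | IsPastList (IsStep G d U) k l} := by
  induction l generalizing k with
  | nil =>
    have : {U : V → I | IsPastList (IsStep G d U) k []} =
        ⋂ w ∈ G.neighborFinset k.1, {U | IsStep G d U (w, k.2) k}ᶜ := by
      ext U
      simp only [IsPastList, Set.mem_ofPred_eq, Set.mem_iInter, Set.mem_compl_iff]
      refine ⟨fun h w _ => h _, fun h u hu => ?_⟩
      have e : (u.1, k.2) = u := by rw [← hu.1]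
      exact h u.1 (by simpa using hu.2.1.symm) (e.symm ▸ hu)
    rw [this]
    exact Finset.measurableSet_biInter _ fun w _ => (measurableSet_isStep _ _).compl
  | cons u l ih => exact (measurableSet_isStep u k).inter (ih u)

/-- Local finiteness leaves countably many possible values of `pastList` at `k`, even if `V` is
uncountable. -/
theorem pastList_mem_iUnion_predLists (hd : ∀ v, G.degree v ≤ d) (U : V → I)
    (k : V × RankPair d) : pastList (IsStep G d U) k ∈ ⋃ n, (predLists G n k : Set _) := by
  by_cases h : ∃ l, IsPastList (IsStep G d U) k l
  · obtain ⟨l, hl⟩ := h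
    rw [hl.pastList_eq (isStep_left_unique hd U)]
    exact Set.mem_iUnion.2 ⟨l.length, mem_predLists_of_isChain hl.isChain⟩
  · rw [pastList, dif_neg h]
    exact Set.mem_iUnion.2 ⟨0, by simp [predLists]⟩

theorem measurableSet_pastList_eq (hd : ∀ v, G.degree v ≤ d) (k : V × RankPair d)
    (l : List (V × RankPair d)) :
    MeasurableSet {U : V → I | pastList (IsStep G d U) k = l} := by
  have hcons : ∀ l ≠ [], MeasurableSet {U : V → I | pastList (IsStep G d U) k = l} := by
    intro l hl
    obtain ⟨u, l, rfl⟩ := List.exists_cons_of_ne_nil hl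
    have : {U : V → I | pastList (IsStep G d U) k = u :: l} =
        {U : V → I | IsPastList (IsStep G d U) k (u :: l)} :=
      Set.ext fun U => ⟨isPastList_of_pastList_eq_cons,
        fun h => h.pastList_eq (isStep_left_unique hd U)⟩
    rw [this]
    exact measurableSet_isPastList k _
  by_cases hl : l = []
  · subst hl
    -- The empty list arises in two ways, as a true past and as the default value, so this event is
    -- obtained as the complement of the others.
    have : {U : V → I | pastList (IsStep G d U) k = []} =
        (⋃ l ∈ (⋃ n, (predLists G n k : Set _)) \ {[]},
          {U : V → I | pastList (IsStep G d U) k = l})ᶜ := by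
      ext U
      simp only [Set.mem_ofPred_eq, Set.mem_compl_iff, Set.mem_iUnion, not_exists]
      constructor
      · intro h l hl h'
        exact hl.2 (h'.symm.trans h)
      · intro h
        by_contra hc
        exact h _ ⟨pastList_mem_iUnion_predLists hd U k, hc⟩ rfl
    rw [this]
    refine (MeasurableSet.biUnion ?_ fun l hl => hcons l hl.2).compl
    exact (Set.countable_iUnion fun n => (Finset.countable_toSet _)).mono Set.sdiff_subset
  · exact hcons l hl

end Steps

/-! ### The color given ordering and sampling labels -/

section LabelColor

variable {V : Type*} {G : SimpleGraph V} {d : ℕ} {h : List (Fin 4) → I → Fin 4}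

/-- The color of a vertex, given the ordering labels `U` and the sampling labels `W`. -/
noncomputable def labelColor (G : SimpleGraph V) (d : ℕ) (h : List (Fin 4) → I → Fin 4)
    (U : V → I) (W : V × RankPair d → I) (v : V) : (Fin d → Bool) × (RankPair d → Fin 4) :=
  (upBits G d U v, fun c => pathColor h (pastList (IsStep G d U)) W (v, c))

theorem labelColor_comp [G.LocallyFinite] (hd : ∀ v, G.degree v ≤ d) (φ : G ≃g G) (U : V → I)
    (W : V × RankPair d → I) (v : V) :
    labelColor G d h (U ∘ φ) (fun k => W (φ k.1, k.2)) v = labelColor G d h U W (φ v) := by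
  let e : V × RankPair d ≃ V × RankPair d := φ.toEquiv.prodCongr (Equiv.refl _)
  have hpast : ∀ k, pastList (IsStep G d U) (e k) = (pastList (IsStep G d (U ∘ φ)) k).map e :=
    pastList_map e (fun _ _ => isStep_comp φ _ _) (isStep_left_unique hd U)
  refine Prod.ext (upBits_comp φ v) (funext fun c => ?_)
  have e1 : (φ v, c) = e (v, c) := rfl
  simp only [labelColor, pathColor]
  rw [e1, hpast, ← pathWord_map]
  rfl

/-- If the bits agree, the edge is a step in some class, and the path colors of that class differ.
Finiteness of the past guarantees that the predecessor really is the head of `pastList`. -/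
theorem labelColor_ne [G.LocallyFinite] (hd : ∀ v, G.degree v ≤ d) (hh : IsSampler h)
    {U : V → I} (W : V × RankPair d → I) {u v : V} (huv : G.Adj u v) (hu : TieFree G U u)
    (hv : TieFree G U v) (hne : U u ≠ U v)
    (hpast : ∀ w, ∀ c : RankPair d, w = u ∨ w = v → ∃ l, IsPastList (IsStep G d U) (w, c) l) :
    labelColor G d h U W u ≠ labelColor G d h U W v := by
  wlog hlt : U u < U v generalizing u v
  · exact (this huv.symm hv hu hne.symm (fun w c hw => hpast w c hw.symm)
      (lt_of_le_of_ne (not_lt.1 hlt) hne.symm)).symm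
  intro e
  obtain ⟨c, hc⟩ := exists_isStep hd huv hu hv hlt (congrArg Prod.fst e)
  have hmem := (mem_head_pastList (isStep_left_unique hd U) (hpast v c (Or.inr rfl))).2 hc
  exact hh.pathColor_ne (isPast_isStep hd U) hmem W (congrFun (congrArg Prod.snd e) c).symm

theorem measurable_labelColor [G.LocallyFinite] (hd : ∀ v, G.degree v ≤ d) (hh : IsSampler h)
    (v : V) : Measurable fun z : (V → I) × (V × RankPair d → I) =>
      labelColor G d h z.1 z.2 v := by
  refine Measurable.prodMk ((measurable_upBits v).comp measurable_fst)
    (measurable_pi_lambda _ fun c => measurable_to_countable' fun a => ?_)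
  have : (fun z : (V → I) × (V × RankPair d → I) =>
      pathColor h (pastList (IsStep G d z.1)) z.2 (v, c)) ⁻¹' {a} =
      ⋃ l ∈ (⋃ n, (predLists G n (v, c) : Set _)),
        {U : V → I | pastList (IsStep G d U) (v, c) = l} ×ˢ
          {W : V × RankPair d → I | h (pathWord h W l) (W (v, c)) = a} := by
    ext z
    simp only [Set.mem_preimage, Set.mem_singleton_iff, Set.mem_iUnion₂, Set.mem_prod,
      Set.mem_ofPred_eq]
    constructor
    · intro hz
      exact ⟨_, pastList_mem_iUnion_predLists hd z.1 (v, c), rfl, hz⟩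
    · rintro ⟨l, -, h1, h2⟩
      rw [pathColor, h1, h2]
  rw [this]
  refine MeasurableSet.biUnion (Set.countable_iUnion fun n => Finset.countable_toSet _)
    fun l _ => (measurableSet_pastList_eq hd _ l).prod
      (hh.measurable_sample l _ (measurableSet_singleton a))

open Classical in
/-- The density of the colors of the vertices in `S`, given the ordering labels. -/
noncomputable def labelDensity (G : SimpleGraph V) (d : ℕ) (h : List (Fin 4) → I → Fin 4)
    (S : Finset V) (a : V → (Fin d → Bool) × (RankPair d → Fin 4)) (U : V → I) : ℝ≥0∞ :=
  if ∀ v ∈ S, upBits G d U v = (a v).1 then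
    pathWeight (stepProb h) (pastList (IsStep G d U)) (S ×ˢ Finset.univ)
      (fun k => (a k.1).2 k.2) else 0

theorem measure_labelColor_right [G.LocallyFinite] (hd : ∀ v, G.degree v ≤ d) (hh : IsSampler h)
    (S : Finset V) (a : V → (Fin d → Bool) × (RankPair d → Fin 4)) (U : V → I) :
    iidUniform (V × RankPair d) {W | ∀ v ∈ S, labelColor G d h U W v = a v} =
      labelDensity G d h S a U := by
  unfold labelDensity
  split_ifs with hb
  · rw [← hh.measure_pathColor (isPast_isStep hd U)]
    congr 1
    ext W
    simp only [Set.mem_ofPred_eq, Finset.mem_product, Finset.mem_univ, and_true, Prod.forall]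
    constructor
    · intro hW v c hv
      exact congrFun (congrArg Prod.snd (hW v hv)) c
    · intro hW v hv
      exact Prod.ext (hb v hv) (funext fun c => hW v c hv)
  · push Not at hb
    obtain ⟨v, hv, hne⟩ := hb
    rw [← measure_empty (μ := iidUniform (V × RankPair d))]
    congr 1
    exact Set.eq_empty_of_forall_notMem fun W hW => hne (congrArg Prod.fst (hW v hv))

theorem measurableSet_labelColor [G.LocallyFinite] (hd : ∀ v, G.degree v ≤ d)
    (hh : IsSampler h) (S : Finset V) (a : V → (Fin d → Bool) × (RankPair d → Fin 4)) :
    MeasurableSet {z : (V → I) × (V × RankPair d → I) |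
      ∀ v ∈ S, labelColor G d h z.1 z.2 v = a v} := by
  have : {z : (V → I) × (V × RankPair d → I) | ∀ v ∈ S, labelColor G d h z.1 z.2 v = a v} =
      ⋂ v ∈ S, (fun z : (V → I) × (V × RankPair d → I) => labelColor G d h z.1 z.2 v) ⁻¹' {a v} := by
    ext z; simp
  rw [this]
  exact Finset.measurableSet_biInter _ fun v _ =>
    measurable_labelColor hd hh v (measurableSet_singleton _)

theorem measure_labelColor [G.LocallyFinite] (hd : ∀ v, G.degree v ≤ d) (hh : IsSampler h)
    (S : Finset V) (a : V → (Fin d → Bool) × (RankPair d → Fin 4)) :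
    (iidUniform V).prod (iidUniform (V × RankPair d))
      {z | ∀ v ∈ S, labelColor G d h z.1 z.2 v = a v} =
      ∫⁻ U, labelDensity G d h S a U ∂iidUniform V := by
  rw [Measure.prod_apply (measurableSet_labelColor hd hh S a)]
  exact lintegral_congr fun U => measure_labelColor_right hd hh S a U

-- A step is an edge of `G`, so no path has a link between `S` and `T`, and the path weight
-- factorizes.
open Classical in
theorem labelDensity_union [G.LocallyFinite] (hd : ∀ v, G.degree v ≤ d) {S T : Finset V}
    (hST : Disjoint S T) (hadj : ∀ v ∈ S, ∀ w ∈ T, ¬ G.Adj v w)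
    (a : V → (Fin d → Bool) × (RankPair d → Fin 4)) (U : V → I) :
    labelDensity G d h (S ∪ T) a U = labelDensity G d h S a U * labelDensity G d h T a U := by
  unfold labelDensity
  by_cases h1 : ∀ v ∈ S, upBits G d U v = (a v).1
  swap
  · rw [if_neg h1, if_neg fun h2 => h1 fun v hv => h2 v (Finset.mem_union_left _ hv), zero_mul]
  by_cases h2 : ∀ v ∈ T, upBits G d U v = (a v).1
  swap
  · rw [if_neg h2, if_neg fun h1 => h2 fun v hv => h1 v (Finset.mem_union_right _ hv), mul_zero]
  rw [if_pos h1, if_pos h2, if_pos fun v hv => (Finset.mem_union.1 hv).elim (h1 v) (h2 v),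
    ← pathWeight_union (isPast_isStep hd U)]
  · congr 1
    ext k
    simp only [Finset.mem_product, Finset.mem_union, Finset.mem_univ, and_true]
  · rw [Finset.disjoint_left] at hST ⊢
    exact fun k hk hk' => hST (Finset.mem_product.1 hk).1 (Finset.mem_product.1 hk').1
  · exact fun k hk u hu hku => hadj _ (Finset.mem_product.1 hk).1 _ (Finset.mem_product.1 hu).1
      (rel_of_mem_head_pastList hku).2.1.symm
  · exact fun k hk u hu hku => hadj _ (Finset.mem_product.1 hu).1 _ (Finset.mem_product.1 hk).1
      (rel_of_mem_head_pastList hku).2.1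

/-- The pasts depend on unboundedly many labels, but once they are finite the density uses only the
bits in `S` and the steps inside `S`, hence only the order pattern on the closed neighborhoods. -/
theorem exists_local_labelDensity [G.LocallyFinite] (hd : ∀ v, G.degree v ≤ d) {S T : Finset V}
    (hT : ∀ v ∈ S, closedNbhd G v ⊆ T) (a : V → (Fin d → Bool) × (RankPair d → Fin 4)) :
    ∃ ψ : (T → I) → ℝ≥0∞, Measurable ψ ∧
      ∀ᵐ U ∂iidUniform V, labelDensity G d h S a U = ψ fun x => U x := by
  have hA : ∀ᵐ U ∂iidUniform V, ∀ k ∈ (S ×ˢ Finset.univ : Finset (V × RankPair d)),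
      ∃ l, IsPastList (IsStep G d U) k l :=
    (Finset.eventually_all _).2 fun k _ => ae_exists_isPastList hd k
  obtain ⟨ψ, hψ, hψ'⟩ := exists_measurable_of_order_pattern T
    {U | ∀ k ∈ (S ×ˢ Finset.univ : Finset (V × RankPair d)), ∃ l, IsPastList (IsStep G d U) k l}
    (labelDensity G d h S a) (by
      intro U hU U' hU' hUU
      have hb : ∀ v ∈ S, upBits G d U v = upBits G d U' v := fun v hv =>
        upBits_congr (containsClosedNbhd_of_subset (hT v hv)) hUU
      unfold labelDensity
      rw [pathWeight_congr_past (isPast_isStep hd U) (isPast_isStep hd U')]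
      · refine if_congr (forall₂_congr fun v hv => by rw [hb v hv]) rfl rfl
      · intro k hk u hu
        rw [mem_head_pastList (isStep_left_unique hd U) (hU k hk),
          mem_head_pastList (isStep_left_unique hd U') (hU' k hk)]
        exact isStep_congr
          (containsClosedNbhd_of_subset (hT _ (Finset.mem_product.1 hu).1))
          (containsClosedNbhd_of_subset (hT _ (Finset.mem_product.1 hk).1)) hUU)
  exact ⟨ψ, hψ, hA.mono hψ'⟩

-- Given `U`, the density of `S ∪ T` is a product whose factors depend on labels in disjoint finite
-- sets; independence of these labels turns the integral of the product into the product of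
-- integrals.
open Classical in
theorem measure_labelColor_union [G.LocallyFinite] (hd : ∀ v, G.degree v ≤ d)
    (hh : IsSampler h) {S T : Finset V}
    (hST : ∀ v ∈ S, ∀ w ∈ T, Disjoint (closedNbhd G v) (closedNbhd G w))
    (a : V → (Fin d → Bool) × (RankPair d → Fin 4)) :
    (iidUniform V).prod (iidUniform (V × RankPair d))
      {z | ∀ v ∈ S ∪ T, labelColor G d h z.1 z.2 v = a v} =
    (iidUniform V).prod (iidUniform (V × RankPair d))
      {z | ∀ v ∈ S, labelColor G d h z.1 z.2 v = a v} *
    (iidUniform V).prod (iidUniform (V × RankPair d))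
      {z | ∀ v ∈ T, labelColor G d h z.1 z.2 v = a v} := by
  have hself : ∀ v, v ∈ closedNbhd G v := fun v => by simp [closedNbhd]
  have hdisj : Disjoint S T := Finset.disjoint_left.2 fun v hv hv' =>
    Finset.disjoint_left.1 (hST v hv v hv') (hself v) (hself v)
  have hadj : ∀ v ∈ S, ∀ w ∈ T, ¬ G.Adj v w := fun v hv w hw hvw =>
    Finset.disjoint_left.1 (hST v hv w hw) (by simp [closedNbhd, hvw]) (hself w)
  obtain ⟨ψ, hψ, hψ'⟩ := exists_local_labelDensity (h := h) hd (S := S)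
    (T := S.biUnion (closedNbhd G)) (fun v hv => Finset.subset_biUnion_of_mem _ hv) a
  obtain ⟨χ, hχ, hχ'⟩ := exists_local_labelDensity (h := h) hd (S := T)
    (T := T.biUnion (closedNbhd G)) (fun v hv => Finset.subset_biUnion_of_mem _ hv) a
  rw [measure_labelColor hd hh, measure_labelColor hd hh, measure_labelColor hd hh,
    lintegral_congr_ae hψ', lintegral_congr_ae hχ']
  have hprod : ∀ᵐ U ∂iidUniform V, labelDensity G d h (S ∪ T) a U =
      ψ (fun x => U x) * χ (fun x => U x) := by
    filter_upwards [hψ', hχ'] with U h1 h2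
    rw [labelDensity_union hd hdisj hadj, h1, h2]
  rw [lintegral_congr_ae hprod]
  have hind : iIndepFun (fun (v : V) (U : V → I) => U v) (iidUniform V) :=
    iIndepFun_infinitePi (X := fun _ x => x) fun _ => measurable_id
  have hind' := hind.indepFun_finset (S.biUnion (closedNbhd G)) (T.biUnion (closedNbhd G))
    (by
      rw [Finset.disjoint_biUnion_left]
      intro v hv
      rw [Finset.disjoint_biUnion_right]
      exact hST v hv) (fun v => measurable_pi_apply v)
  exact lintegral_mul_eq_lintegral_mul_lintegral_of_indepFun
    (hψ.comp (measurable_pi_lambda _ fun x => measurable_pi_apply _))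
    (hχ.comp (measurable_pi_lambda _ fun x => measurable_pi_apply _)) (hind'.comp hψ hχ)

end LabelColor

theorem indepFun_of_finite {Ω α β : Type*} [MeasurableSpace Ω] {μ : Measure Ω}
    [IsProbabilityMeasure μ] [Finite α] [Finite β] [MeasurableSpace α] [MeasurableSpace β]
    [MeasurableSingletonClass α] [MeasurableSingletonClass β] {X : Ω → α} {Y : Ω → β}
    (hX : Measurable X) (hY : Measurable Y)
    (h : ∀ a b, μ {ω | X ω = a ∧ Y ω = b} = μ {ω | X ω = a} * μ {ω | Y ω = b}) :
    IndepFun X Y μ := by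
  rw [indepFun_iff_map_prod_eq_prod_map_map hX.aemeasurable hY.aemeasurable]
  refine Measure.ext_of_singleton fun p => ?_
  rw [Measure.map_apply (hX.prodMk hY) (measurableSet_singleton p), ← Set.singleton_prod_singleton,
    Measure.prod_prod, Measure.map_apply hX (measurableSet_singleton _),
    Measure.map_apply hY (measurableSet_singleton _)]
  refine Eq.trans ?_ (h p.1 p.2)
  congr 1

/-! ### Locality: the radius that determines a color -/

section Locality

variable {V : Type*} {G : SimpleGraph V} {d : ℕ}

theorem edist_le_of_adj {u v w : V} (h : G.Adj u v) {n : ℕ} (hw : G.edist v w ≤ n) :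
    G.edist u w ≤ (n + 1 : ℕ) := by
  refine (G.edist_triangle (v := v)).trans ?_
  rw [SimpleGraph.edist_eq_one_iff_adj.2 h, Nat.cast_add, Nat.cast_one, add_comm]
  gcongr

theorem containsClosedNbhd_of_edist_le {T : Set V} {v : V} {n : ℕ}
    (h : ∀ w, G.edist v w ≤ (n + 1 : ℕ) → w ∈ T) : ContainsClosedNbhd G T v :=
  ⟨h v (by simp), fun w hw => h w
    (edist_le_of_adj hw (by simp : G.edist w w ≤ (n : ℕ)))⟩

/-- The radius is two because the ranks at the neighbor `u` involve the neighbors of `u`. -/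
theorem isStep_congr_of_eq_on_ball {U U' : V → I} {k u : V × RankPair d} (hu : G.Adj k.1 u.1)
    (hU : ∀ w, G.edist k.1 w ≤ (2 : ℕ) → U' w = U w) :
    IsStep G d U' u k ↔ IsStep G d U u k := by
  refine isStep_congr (T := {w | U' w = U w}) ?_ ?_ fun x hx y hy => ?_
  · exact containsClosedNbhd_of_edist_le (n := 0) fun w hw => hU w (edist_le_of_adj hu hw)
  · exact containsClosedNbhd_of_edist_le (n := 0) fun w hw =>
      hU w (hw.trans (Nat.cast_le.2 (by omega)))
  · have hx : U' x = U x := hx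
    have hy : U' y = U y := hy
    rw [hx, hy]

theorem IsPastList.of_eq_on_ball {U U' : V → I} {k : V × RankPair d}
    {l : List (V × RankPair d)} (h : IsPastList (IsStep G d U) k l)
    (hU : ∀ w, G.edist k.1 w ≤ (l.length + 2 : ℕ) → U' w = U w) :
    IsPastList (IsStep G d U') k l ∧ ∀ i ∈ k :: l, G.edist k.1 i.1 ≤ (l.length : ℕ) := by
  induction l generalizing k with
  | nil =>
    refine ⟨fun u hu => h u ((isStep_congr_of_eq_on_ball hu.2.1.symm fun w hw => hU w hw).1 hu), ?_⟩
    simp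
  | cons u l ih =>
    have hadj : G.Adj k.1 u.1 := h.1.2.1.symm
    have hU' : ∀ w, G.edist u.1 w ≤ (l.length + 2 : ℕ) → U' w = U w := by
      intro w hw
      refine hU w ?_
      rw [List.length_cons, show l.length + 1 + 2 = l.length + 2 + 1 by ring]
      exact edist_le_of_adj hadj hw
    obtain ⟨h1, h2⟩ := ih h.2 hU'
    refine ⟨⟨(isStep_congr_of_eq_on_ball hadj fun w hw =>
      hU w (hw.trans (Nat.cast_le.2 (by omega)))).2 h.1, h1⟩, fun i hi => ?_⟩
    rw [List.mem_cons] at hi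
    rcases hi with rfl | hi
    · simp
    · exact edist_le_of_adj hadj (h2 i hi)

theorem pathWord_congr {K : Type*} {h : List (Fin 4) → I → Fin 4} {W W' : K → I} {l : List K}
    (hW : ∀ i ∈ l, W i = W' i) : pathWord h W l = pathWord h W' l := by
  induction l with
  | nil => rfl
  | cons k l ih =>
    rw [pathWord, pathWord, ih fun i hi => hW i (List.mem_cons_of_mem _ hi), hW k (by simp)]

theorem exists_radius_labelColor [G.LocallyFinite] (hd : ∀ v, G.degree v ≤ d)
    (h : List (Fin 4) → I → Fin 4) {U : V → I} (W : V × RankPair d → I) {v : V}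
    (hv : ∀ c, ∃ l, IsPastList (IsStep G d U) (v, c) l) :
    ∃ r : ℕ, ∀ U' W', (∀ w, G.edist v w ≤ r → U' w = U w ∧ ∀ c, W' (w, c) = W (w, c)) →
      labelColor G d h U' W' v = labelColor G d h U W v := by
  choose l hl using hv
  -- All classes are covered at once: a past of length `n` stays within distance `n`, and verifying
  -- its steps, and that it stops, needs two more.
  refine ⟨∑ c, (l c).length + 2, fun U' W' hUW => Prod.ext ?_ (funext fun c => ?_)⟩
  · refine upBits_congr (T := {w | U' w = U w}) ?_ fun x hx y hy => ?_
    · refine containsClosedNbhd_of_edist_le (n := 0) fun w hw => (hUW w ?_).1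
      exact hw.trans (Nat.cast_le.2 (by omega))
    · have hx : U' x = U x := hx
      have hy : U' y = U y := hy
      rw [hx, hy]
  · have hle : (l c).length ≤ ∑ c, (l c).length :=
      Finset.single_le_sum (f := fun c => (l c).length) (fun _ _ => Nat.zero_le _)
        (Finset.mem_univ c)
    obtain ⟨h1, h2⟩ := (hl c).of_eq_on_ball fun w hw =>
      (hUW w (hw.trans (by gcongr))).1
    have hW : ∀ i ∈ (v, c) :: l c, W' i = W i := fun i hi =>
      (hUW i.1 ((h2 i hi).trans (Nat.cast_le.2 (by omega)))).2 i.2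
    simp only [labelColor, pathColor, h1.pastList_eq (isStep_left_unique hd U'),
      (hl c).pastList_eq (isStep_left_unique hd U)]
    rw [pathWord_congr fun i hi => hW i (List.mem_cons_of_mem _ hi), hW (v, c) (by simp)]

theorem disjoint_closedNbhd_of_lt_edist [G.LocallyFinite] {v w : V}
    (h : ((4 : ℕ) : ℕ∞) < G.edist v w) : Disjoint (closedNbhd G v) (closedNbhd G w) := by
  have hle : ∀ {v x}, x ∈ closedNbhd G v → G.edist v x ≤ 1 := by
    intro v x hx
    classical
    rcases Finset.mem_insert.1 hx with rfl | hx
    · simp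
    · exact (SimpleGraph.edist_eq_one_iff_adj.2 (by simpa using hx)).le
  refine Finset.disjoint_left.2 fun x hx hx' => not_le.2 h ?_
  have h2 := hle hx'
  rw [SimpleGraph.edist_comm] at h2
  -- A common vertex would give distance at most `1 + 1`, so there is room to spare below `4`.
  exact G.edist_triangle.trans ((add_le_add (hle hx) h2).trans (by norm_num))

end Locality

/-! ### The factor map and its dependence -/

section FactorColor

variable {V : Type*} {G : SimpleGraph V} {d : ℕ} {h : List (Fin 4) → I → Fin 4}
  {f : I → Option (RankPair d) → I}

/-- The color of a vertex, given labels that `f` splits into ordering and sampling labels. -/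
noncomputable def factorColor (G : SimpleGraph V) (d : ℕ) (h : List (Fin 4) → I → Fin 4)
    (f : I → Option (RankPair d) → I) (ω : V → I) (v : V) :
    (Fin d → Bool) × (RankPair d → Fin 4) :=
  labelColor G d h (fun v => f (ω v) none) (fun k => f (ω k.1) (some k.2)) v

theorem measurable_split (hf : Measurable f) :
    Measurable fun ω : V → I => ((fun v => f (ω v) none),
      (fun k : V × RankPair d => f (ω k.1) (some k.2))) := by
  refine Measurable.prodMk ?_ ?_
  · exact measurable_pi_lambda _ fun v =>
      (measurable_pi_apply none).comp (hf.comp (measurable_pi_apply v))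
  · exact measurable_pi_lambda _ fun k =>
      (measurable_pi_apply (some k.2)).comp (hf.comp (measurable_pi_apply k.1))

theorem measurable_factorColor [G.LocallyFinite] (hd : ∀ v, G.degree v ≤ d) (hh : IsSampler h)
    (hf : Measurable f) (v : V) : Measurable fun ω => factorColor G d h f ω v :=
  (measurable_labelColor hd hh v).comp (measurable_split hf)

theorem ae_ordering_labels (hf : Measurable f)
    (hf' : (volume : Measure I).map f = iidUniform (Option (RankPair d)))
    {p : (V → I) → Prop} (hp : ∀ᵐ U ∂iidUniform V, p U) :
    ∀ᵐ ω ∂iidUniform V, p fun v => f (ω v) none := by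
  have h1 : ∀ᵐ z ∂(iidUniform V).prod (iidUniform (V × RankPair d)), p z.1 :=
    Measure.quasiMeasurePreserving_fst.ae hp
  rw [← map_split_label hf hf'] at h1
  exact ae_of_ae_map (measurable_split hf).aemeasurable h1

theorem measure_factorColor [G.LocallyFinite] (hd : ∀ v, G.degree v ≤ d) (hh : IsSampler h)
    (hf : Measurable f) (hf' : (volume : Measure I).map f = iidUniform (Option (RankPair d)))
    (S : Finset V) (a : V → (Fin d → Bool) × (RankPair d → Fin 4)) :
    iidUniform V {ω | ∀ v ∈ S, factorColor G d h f ω v = a v} =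
      (iidUniform V).prod (iidUniform (V × RankPair d))
        {z | ∀ v ∈ S, labelColor G d h z.1 z.2 v = a v} := by
  rw [← map_split_label hf hf', Measure.map_apply (measurable_split hf)
    (measurableSet_labelColor hd hh S a)]
  rfl

theorem indepFun_factorColor [G.LocallyFinite] (hd : ∀ v, G.degree v ≤ d) (hh : IsSampler h)
    (hf : Measurable f) (hf' : (volume : Measure I).map f = iidUniform (Option (RankPair d)))
    {A B : Set V}
    (hAB : ∀ v ∈ A, ∀ w ∈ B, Disjoint (closedNbhd G v) (closedNbhd G w)) :
    IndepFun (fun ω (v : A) => factorColor G d h f ω v)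
      (fun ω (v : B) => factorColor G d h f ω v) (iidUniform V) := by
  classical
  have hm := measurable_factorColor (G := G) hd hh hf
  refine IndepFun.process_indepFun_process (fun v => hm v) (fun v => hm v) fun S T => ?_
  refine indepFun_of_finite (measurable_pi_lambda _ fun v => hm v)
    (measurable_pi_lambda _ fun v => hm v) fun a b => ?_
  let S' : Finset V := S.map (Function.Embedding.subtype _)
  let T' : Finset V := T.map (Function.Embedding.subtype _)
  have hS' : ∀ v, v ∈ S' ↔ ∃ hv : v ∈ A, (⟨v, hv⟩ : A) ∈ S := by simp [S']
  have hT' : ∀ v, v ∈ T' ↔ ∃ hv : v ∈ B, (⟨v, hv⟩ : B) ∈ T := by simp [T']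
  have hST : ∀ v ∈ S', ∀ w ∈ T', Disjoint (closedNbhd G v) (closedNbhd G w) :=
    fun v hv w hw => hAB v ((hS' v).1 hv).1 w ((hT' w).1 hw).1
  -- The prescribed values on `S` and `T` are combined into one coloring, consistently as the two
  -- sets are disjoint; the value elsewhere is irrelevant.
  let c : V → (Fin d → Bool) × (RankPair d → Fin 4) := fun v =>
    if hv : ∃ hv : v ∈ A, (⟨v, hv⟩ : A) ∈ S then a ⟨⟨v, hv.1⟩, hv.2⟩
    else if hv : ∃ hv : v ∈ B, (⟨v, hv⟩ : B) ∈ T then b ⟨⟨v, hv.1⟩, hv.2⟩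
    else (fun _ => false, fun _ => 0)
  have hcS : ∀ v : S, c (v : A) = a v := fun v => by
    have : ∃ hv : ((v : A) : V) ∈ A, (⟨(v : A), hv⟩ : A) ∈ S := ⟨v.1.2, v.2⟩
    simp only [c, dif_pos this]
  have hcT : ∀ v : T, c (v : B) = b v := fun v => by
    have h1 : ∃ hv : ((v : B) : V) ∈ B, (⟨(v : B), hv⟩ : B) ∈ T := ⟨v.1.2, v.2⟩
    have h2 : ¬ ∃ hv : ((v : B) : V) ∈ A, (⟨(v : B), hv⟩ : A) ∈ S := by
      intro h2
      exact Finset.disjoint_left.1 (hST _ ((hS' _).2 h2) _ ((hT' _).2 h1))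
        (Finset.mem_insert_self _ _) (Finset.mem_insert_self _ _)
    simp only [c, dif_neg h2, dif_pos h1]
  have eS : {ω : V → I | (fun v : S => factorColor G d h f ω (v : A)) = a} =
      {ω | ∀ v ∈ S', factorColor G d h f ω v = c v} := by
    ext ω
    simp only [Set.mem_ofPred_eq, funext_iff, ← hcS]
    exact ⟨fun hω v hv => hω ⟨⟨v, ((hS' v).1 hv).1⟩, ((hS' v).1 hv).2⟩,
      fun hω v => hω _ ((hS' _).2 ⟨v.1.2, v.2⟩)⟩
  have eT : {ω : V → I | (fun v : T => factorColor G d h f ω (v : B)) = b} =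
      {ω | ∀ v ∈ T', factorColor G d h f ω v = c v} := by
    ext ω
    simp only [Set.mem_ofPred_eq, funext_iff, ← hcT]
    exact ⟨fun hω v hv => hω ⟨⟨v, ((hT' v).1 hv).1⟩, ((hT' v).1 hv).2⟩,
      fun hω v => hω _ ((hT' _).2 ⟨v.1.2, v.2⟩)⟩
  have eST : {ω : V → I | (fun v : S => factorColor G d h f ω (v : A)) = a ∧
      (fun v : T => factorColor G d h f ω (v : B)) = b} =
      {ω | ∀ v ∈ S' ∪ T', factorColor G d h f ω v = c v} := by
    rw [Set.ofPred_and, eS, eT]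
    ext ω
    simp only [Set.mem_inter_iff, Set.mem_ofPred_eq, Finset.mem_union, or_imp, forall_and]
  rw [eST, eS, eT, measure_factorColor hd hh hf hf', measure_factorColor hd hh hf hf',
    measure_factorColor hd hh hf hf', measure_labelColor_union hd hh hST]

/-- The exact count is `2 ^ d * 4 ^ (d.choose 2)`; bounding `2 ^ d` by `4 ^ d` gives the exponent `d
+ d.choose 2 = d * (d + 1) / 2`. -/
theorem card_color_le (d : ℕ) :
    Fintype.card ((Fin d → Bool) × (RankPair d → Fin 4)) ≤ 4 ^ (d * (d + 1) / 2) := by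
  rw [Fintype.card_prod, Fintype.card_fun, Fintype.card_fun, Sym2.card_subtype_not_diag,
    Fintype.card_fin, Fintype.card_bool, Fintype.card_fin]
  have : d * (d + 1) / 2 = d + d.choose 2 := by
    have := Nat.choose_two_right (d + 1)
    rw [Nat.choose_succ_succ' d 1, Nat.choose_one_right] at this
    rw [this, mul_comm]
    simp
  rw [this, pow_add]
  gcongr
  norm_num

end FactorColor

/-! ### Assembly of the theorem -/

theorem theorem1 {V : Type*} (G : SimpleGraph V) (d : ℕ)
    (hd : ∀ v : V, (G.neighborSet v).encard ≤ (d : ℕ∞)) :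
    ∃ F : (V → I) → V → Fin (4 ^ (d * (d + 1) / 2)),
      IsFactorMap G F ∧ IsFinitary G F ∧
        IsRandomProperColoring G F (iidUniform V) ∧ IsKDependent G 4 F (iidUniform V) := by
  have hfin : ∀ v, (G.neighborSet v).Finite := fun v => Set.finite_of_encard_le_coe (hd v)
  let _ : G.LocallyFinite := fun v => (hfin v).fintype
  have hd' : ∀ v, G.degree v ≤ d := by
    intro v
    have := hd v
    rw [← SimpleGraph.coe_neighborFinset, Set.encard_coe_eq_coe_finsetCard,
      G.card_neighborFinset_eq_degree] at this
    exact_mod_cast this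
  obtain ⟨h, hh⟩ := exists_isSampler
  obtain ⟨f, hf, hf'⟩ := exists_split_label (Option (RankPair d))
  obtain ⟨e⟩ : Nonempty ((Fin d → Bool) × (RankPair d → Fin 4) ↪ Fin (4 ^ (d * (d + 1) / 2))) :=
    Function.Embedding.nonempty_of_card_le (by simpa using card_color_le d)
  have he : Measurable e := measurable_of_finite _
  refine ⟨fun ω v => e (factorColor G d h f ω v), ⟨?_, ?_⟩, ?_, ?_, ?_⟩
  · exact measurable_pi_lambda _ fun v => he.comp (measurable_factorColor hd' hh hf v)
  · intro φ ω v
    exact congrArg e (labelColor_comp hd' φ (fun v => f (ω v) none)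
      (fun k => f (ω k.1) (some k.2)) v)
  · intro v
    have h1 : ∀ᵐ U ∂iidUniform V, ∀ c, ∃ l, IsPastList (IsStep G d U) (v, c) l :=
      ae_all_iff.2 fun c => ae_exists_isPastList hd' (v, c)
    filter_upwards [ae_ordering_labels hf hf' h1] with ω hω
    obtain ⟨r, hr⟩ := exists_radius_labelColor hd' h (fun k => f (ω k.1) (some k.2)) hω
    refine ⟨r, fun ω' hω' => congrArg e (hr _ _ fun w hw => ?_)⟩
    simp [hω' w hw]
  · intro S hS
    have := hS.to_subtype
    -- Countability of `S` is what combines the null events for its vertices and pairs of vertices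
    -- into one.
    have h1 : ∀ᵐ U ∂iidUniform V, ∀ u : S, TieFree G U u ∧
        (∀ c, ∃ l, IsPastList (IsStep G d U) ((u : V), c) l) ∧
        ∀ v : S, (u : V) ≠ v → U u ≠ U v := by
      refine ae_all_iff.2 fun u => ?_
      refine (ae_tieFree (u : V)).and ((ae_all_iff.2 fun c => ae_exists_isPastList hd' _).and
        (ae_all_iff.2 fun v => ?_))
      by_cases huv : (u : V) = v
      · exact Filter.Eventually.of_forall fun U hne => absurd huv hne
      · exact (ae_ne_iidUniform huv).mono fun U hU _ => hU
    filter_upwards [ae_ordering_labels hf hf' h1] with ω hω u hu v hv huv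
    obtain ⟨h2, h3, h4⟩ := hω ⟨u, hu⟩
    obtain ⟨h5, h6, -⟩ := hω ⟨v, hv⟩
    refine e.injective.ne (labelColor_ne hd' hh _ huv h2 h5 (h4 ⟨v, hv⟩ huv.ne) ?_)
    rintro w c (rfl | rfl)
    · exact h3 c
    · exact h6 c
  · intro A B hAB
    have hind := indepFun_factorColor (G := G) hd' hh hf hf' (A := A) (B := B)
      fun v hv w hw => disjoint_closedNbhd_of_lt_edist (hAB v hv w hw)
    exact hind.comp (φ := fun x (v : A) => e (x v)) (ψ := fun x (v : B) => e (x v))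
      (measurable_pi_lambda _ fun v => he.comp (measurable_pi_apply v))
      (measurable_pi_lambda _ fun v => he.comp (measurable_pi_apply v))
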